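/- **Setting.** Let $\Phi,\Psi$ be Hermitian $2\times 2$ matrices with $\det\Phi<0$. For a $2\times2$ matrix $\Theta$ write $q_\Theta(\mu,\nu)=\begin{bmatrix}\mu\\ \nu\end{bmatrix}^H\Theta\begin{bmatrix}\mu\\ \nu\end{bmatrix}$, and let $$\mathcal C=\{(\mu,\nu)\in\mathbf C^2 \mid (\mu,\nu)\ne 0,\ q_\Phi(\mu,\nu)=0,\ q_\Psi(\mu,\nu)\le 0\}.$$ Assume that the subset of the closed complex plane represented by $\mathcal C$ in homogeneous coordinates is neither empty nor a singleton, i.e. $\mathcal C$ contains two linearly independent vectors. For $F,G\in\mathbf C^{p\times n}$ let $$\mathcal A(F,G)=\{a\in\mathbf C^n\mid (\mu G-\nu F)a=0 \text{ for some } (\mu,\nu)\in\mathcal C\}.$$ Let $F_i,G_i\in\mathbf C^{p_i\times n_i}$ and $E_i\in\mathbf C^{m_i\times n_i}$ ($i=1,2$), $F=\mathrm{diag}(F_1,F_2)$, $G=\mathrm{diag}(G_1,G_2)$, $E=\mathrm{diag}(E_1,E_2)$ (block-diagonal), $p=p_1+p_2$ and $\mathcal A=\mathcal A(F,G)$. Define,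 with finite sums of arbitrary length and $\inf\emptyset=+\infty$, $$g(X)=\inf\Big\{\sum_k\|Ea_k\|^2 \;\Big|\; X=\sum_k a_ka_k^H,\ a_k\in\mathcal A\Big\},\qquad h(Y)=\frac12\inf_{V,W} g\Big(\begin{bmatrix}V&Y\\Y^H&W\end{bmatrix}\Big)\quad (Y\in\mathbf C^{n_1\times n_2}),$$ and $h^*(Z)=\sup_Y\big(\Re\operatorname{tr}(Z^HY)-h(Y)\big)$ for $Z\in\mathbf C^{n_1\times n_2}$. **(a)** Assume that $\operatorname{rank}(\mu G-\nu F)=p$ for all $(\mu,\nu)\neq 0$. Then for every $Z\in\mathbf C^{n_1\times n_2}$ the following are equivalent: 1. $h^*(Z)=0$; 2. there are Hermitian $P,Q\in\mathbf C^{p\times p}$ with $Q\succeq 0$ and $$\begin{bmatrix}0&Z\\Z^H&0\end{bmatrix}-\begin{bmatrix}F\\G\end{bmatrix}^H(\Phi\otimes P+\Psi\otimes Q)\begin{bmatrix}F\\G\end{bmatrix}\preceq\begin{bmatrix}E_1^HE_1&0\\0&E_2^HE_2\end{bmatrix};$$ 3. $\Re(v^HZw)\le(\|E_1v\|^2+\|E_2w\|^2)/2$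 for all $(v,w)\in\mathcal A$; 4. $\Re(v^HZw)\le\|E_1v\|\,\|E_2w\|$ for all $(v,w)\in\mathcal A$. If they fail, then $h^*(Z)=+\infty$. **(b)** Let $A\in\mathbf C^{n_s\times n_s}$, $B\in\mathbf C^{n_s\times m}$, $C\in\mathbf C^{l\times n_s}$, $D\in\mathbf C^{l\times m}$, where $A$ has no eigenvalue $\lambda$ with $(\lambda,1)\in\mathcal C$. Take $p_1=0$, $n_1=l$, $p_2=n_s$, $n_2=n_s+m$, $G_2=[\,I\ \ 0\,]$, $F_2=[\,A\ \ B\,]$, $E_1=I$, $E_2=[\,0\ \ I\,]$, $Z=[\,C\ \ D\,]$ (so that $\mathcal A=\mathbf C^l\times\mathcal A_2$ with $\mathcal A_2=\mathcal A(F_2,G_2)$). Then condition 4 is equivalent to $\|Zw\|\le\|E_2w\|$ for all $w\in\mathcal A_2$, and also to the transfer-function bound $$\|D+C(\lambda I-A)^{-1}B\|_2\le1\ \text{ for all }(\lambda,1)\in\mathcal C,\qquad \|D\|_2\le 1\ \text{ if }(1,0)\in\mathcal C,$$ where $\|\cdot\|_2$ is the spectral norm. Moreover $h^*(Z)=0$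 if this bound holds and $h^*(Z)=+\infty$ otherwise; and if in addition $\operatorname{rank}(\mu G_2-\nu F_2)=n_s$ for all $(\mu,\nu)\ne0$, then the linear matrix inequality in 2 is feasible if and only if this bound holds. -/

import Mathlib

open Matrix
open scoped Kronecker ComplexOrder

namespace PencilGauge

noncomputable section

/-- The Euclidean norm of a complex vector. -/
def euclNorm {ι : Type*} [Fintype ι] (x : ι → ℂ) : ℝ :=
  ‖(WithLp.toLp 2 x : EuclideanSpace ℂ ι)‖

section
open scoped Matrix.Norms.L2Operator

/-- The spectral norm (largest singular value) of a complex matrix, that is, its operator norm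
with respect to the Euclidean norms. -/
def specNorm {l m : Type*} [Fintype l] [Fintype m] [DecidableEq m] (M : Matrix l m ℂ) : ℝ :=
  ‖M‖

end

/-- The quadratic form `q_Θ(μ, ν) = (μ, ν)ᴴ Θ (μ, ν)`; its value is real if `Θ` is Hermitian. -/
def quadForm (Θ : Matrix (Fin 2) (Fin 2) ℂ) (μ ν : ℂ) : ℂ :=
  star ![μ, ν] ⬝ᵥ (Θ *ᵥ ![μ, ν])

/-- The segment of a line or circle determined by `Φ` and `Ψ`, in homogeneous coordinates:
the nonzero pairs `(μ, ν)` with `q_Φ(μ, ν) = 0` and `q_Ψ(μ, ν) ≤ 0`. -/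
def curve (Φ Ψ : Matrix (Fin 2) (Fin 2) ℂ) : Set (ℂ × ℂ) :=
  {c | c ≠ 0 ∧ quadForm Φ c.1 c.2 = 0 ∧ (quadForm Ψ c.1 c.2).re ≤ 0}

/-- The subset of the closed complex plane represented by `curve Φ Ψ` is neither empty nor a
singleton: it has two elements that represent different points. -/
def CurveNontrivial (Φ Ψ : Matrix (Fin 2) (Fin 2) ℂ) : Prop :=
  ∃ c ∈ curve Φ Ψ, ∃ d ∈ curve Φ Ψ, c.1 * d.2 ≠ d.1 * c.2

/-- The set `𝒜` of the vectors `a` with `(μ G - ν F) a = 0` for some `(μ, ν)` on the curve. -/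
def dict {p n : Type*} [Fintype n] (Φ Ψ : Matrix (Fin 2) (Fin 2) ℂ) (F G : Matrix p n ℂ) :
    Set (n → ℂ) :=
  {a | ∃ c ∈ curve Φ Ψ, (c.1 • G - c.2 • F) *ᵥ a = 0}

/-- `μ G - ν F` has full row rank for all `(μ, ν) ≠ 0`. -/
def FullRowRank {p n : Type*} [Fintype p] [Fintype n] (F G : Matrix p n ℂ) : Prop :=
  ∀ μ ν : ℂ, (μ, ν) ≠ 0 → (μ • G - ν • F).rank = Fintype.card p

/-- The gauge
`g(X) = inf {∑ₖ ‖E aₖ‖² | X = ∑ₖ aₖ aₖᴴ, aₖ ∈ 𝒜}`, with finite sums of any length;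
it is `+∞` if `X` has no such decomposition. -/
def symmGauge {p n m : Type*} [Fintype n] [Fintype m] (Φ Ψ : Matrix (Fin 2) (Fin 2) ℂ)
    (F G : Matrix p n ℂ) (E : Matrix m n ℂ) (X : Matrix n n ℂ) : EReal :=
  ⨅ (r : ℕ) (a : Fin r → n → ℂ)
    (_ : (∀ k, a k ∈ dict Φ Ψ F G) ∧ X = ∑ k, vecMulVec (a k) (star (a k))),
    ((∑ k, euclNorm (E *ᵥ a k) ^ 2 : ℝ) : EReal)

/-- The block-diagonal matrix with diagonal blocks `M₁` and `M₂`. -/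
abbrev diagBlocks {p₁ p₂ n₁ n₂ : Type*} (M₁ : Matrix p₁ n₁ ℂ) (M₂ : Matrix p₂ n₂ ℂ) :
    Matrix (p₁ ⊕ p₂) (n₁ ⊕ n₂) ℂ :=
  fromBlocks M₁ 0 0 M₂

section NonSymmetric

variable {p₁ p₂ n₁ n₂ m₁ m₂ : Type*} [Fintype p₁] [Fintype p₂] [Fintype n₁] [Fintype n₂]
  [Fintype m₁] [Fintype m₂]

/-- The non-symmetric gauge `h(Y) = (1/2) inf_{V,W} g([V, Y; Yᴴ, W])`, where `g` is the gauge for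
the block-diagonal matrices `F = diag(F₁, F₂)`, `G = diag(G₁, G₂)`, `E = diag(E₁, E₂)`.
(`g` is `+∞` at matrices that are not Hermitian, so `V` and `W` may range over all matrices.) -/
def nonsymmGauge (Φ Ψ : Matrix (Fin 2) (Fin 2) ℂ) (F₁ G₁ : Matrix p₁ n₁ ℂ)
    (F₂ G₂ : Matrix p₂ n₂ ℂ) (E₁ : Matrix m₁ n₁ ℂ) (E₂ : Matrix m₂ n₂ ℂ)
    (Y : Matrix n₁ n₂ ℂ) : EReal :=
  ((1 / 2 : ℝ) : EReal) * ⨅ (V : Matrix n₁ n₁ ℂ) (W : Matrix n₂ n₂ ℂ),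
    symmGauge Φ Ψ (diagBlocks F₁ F₂) (diagBlocks G₁ G₂) (diagBlocks E₁ E₂)
      (fromBlocks V Y Yᴴ W)

/-- The convex conjugate `f*(Z) = sup_Y (Re tr(Zᴴ Y) - f(Y))` of an extended-valued function on
complex matrices, for the real inner product `Re tr(Zᴴ Y)`. -/
def conjugate (f : Matrix n₁ n₂ ℂ → EReal) (Z : Matrix n₁ n₂ ℂ) : EReal :=
  ⨆ Y : Matrix n₁ n₂ ℂ, (((Zᴴ * Y).trace.re : ℝ) : EReal) - f Y

/-- The stacked matrix `[F; G]`. -/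
def stack {p n : Type*} (F G : Matrix p n ℂ) : Matrix (Fin 2 × p) n ℂ :=
  Matrix.of fun i j => ![F, G] i.1 i.2 j

/-- There are a Hermitian `P` and a Hermitian `Q ⪰ 0` such that
`[0, Z; Zᴴ, 0] - [F; G]ᴴ (Φ ⊗ P + Ψ ⊗ Q) [F; G] ⪯ diag(E₁ᴴ E₁, E₂ᴴ E₂)`. -/
def LMIFeasible (Φ Ψ : Matrix (Fin 2) (Fin 2) ℂ) (F₁ G₁ : Matrix p₁ n₁ ℂ)
    (F₂ G₂ : Matrix p₂ n₂ ℂ) (E₁ : Matrix m₁ n₁ ℂ) (E₂ : Matrix m₂ n₂ ℂ)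
    (Z : Matrix n₁ n₂ ℂ) : Prop :=
  ∃ P Q : Matrix (p₁ ⊕ p₂) (p₁ ⊕ p₂) ℂ, P.IsHermitian ∧ Q.PosSemidef ∧
    (diagBlocks (E₁ᴴ * E₁) (E₂ᴴ * E₂)
      - (fromBlocks 0 Z Zᴴ 0
        - (stack (diagBlocks F₁ F₂) (diagBlocks G₁ G₂))ᴴ * (Φ ⊗ₖ P + Ψ ⊗ₖ Q)
          * stack (diagBlocks F₁ F₂) (diagBlocks G₁ G₂))).PosSemidef

end NonSymmetric

/-- The bound `‖D + C (λ I - A)⁻¹ B‖₂ ≤ 1` for all `(λ, 1)` on the curve, together with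
`‖D‖₂ ≤ 1` if the point at infinity `(1, 0)` is on the curve. -/
def TransferBound {s m l : Type*} [Fintype s] [Fintype m] [Fintype l] [DecidableEq s]
    [DecidableEq m] (Φ Ψ : Matrix (Fin 2) (Fin 2) ℂ) (A : Matrix s s ℂ) (B : Matrix s m ℂ)
    (C : Matrix l s ℂ) (D : Matrix l m ℂ) : Prop :=
  (∀ z : ℂ, (z, (1 : ℂ)) ∈ curve Φ Ψ →
    specNorm (D + C * (z • (1 : Matrix s s ℂ) - A)⁻¹ * B) ≤ 1) ∧
  (((1 : ℂ), (0 : ℂ)) ∈ curve Φ Ψ → specNorm D ≤ 1)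

end

end PencilGauge

/-! Everything is compared with the bound 3 (`SumBound`). Condition 4 follows from it because the
pencil is block-diagonal: `v` and `w` can be rescaled independently within `𝒜`, and optimizing over
`(t v, t⁻¹ w)` turns the arithmetic mean into the geometric one. The conjugate needs no duality: a
decomposition of a matrix with off-diagonal block `Y` writes `Y` as a sum of `vₖ wₖᴴ`, so the bound
summed over `k` gives `Re tr(Zᴴ Y) ≤ h(Y)`, while one violating pair, scaled up, drives `h*` to
`+∞`.

The substantial step is from the bound to the linear matrix inequality, the generalized
Kalman-Yakubovich-Popov lemma `kypProperty_of_curveNontrivial`. A change of homogeneous coordinates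
that sends two points of the curve to infinity and zero puts it on the extended real line; a further
change makes it the whole line or a half-line. There `exists_certificate` argues by duality. The
certified matrices form a closed convex cone, so a matrix `M` outside it is separated by some `X ⪰
0` with `F X Gᴴ` Hermitian (and positive semidefinite on the half-line). If `F X Gᴴ` is invertible,
diagonalizing a Hermitian matrix splits `X` into dyads `a aᴴ` with `F a = t G a`, on which `M` is
nonnegative: a contradiction. A small perturbation reduces to the invertible case.

Both the closedness of the cone and the perturbation rest on one fact about pencils of full row
rank: the kernels of `F - t G` for large real `t` span the whole space.

For the state-space pencil the first block imposes no constraint on `v`, and `𝒜₂` is parametrized by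
the input through the resolvent. -/

namespace PencilGauge

/-! ### Kernels of pencils of full row rank -/

/-- Every pencil matrix `μ G - ν F` with `(μ, ν) ≠ 0` has trivial left kernel. -/
def LeftRegular {p n : Type*} [Fintype p] (F G : Matrix p n ℂ) : Prop :=
  ∀ μ ν : ℂ, (μ, ν) ≠ 0 → ∀ z : p → ℂ, z ᵥ* (μ • G - ν • F) = 0 → z = 0

theorem rank_eq_card_iff_forall_exists_mulVec_eq {p n : Type*} [Fintype p] [Fintype n]
    (M : Matrix p n ℂ) : M.rank = Fintype.card p ↔ ∀ y, ∃ a, M *ᵥ a = y := by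
  rw [Matrix.rank, ← Module.finrank_fintype_fun_eq_card ℂ]
  constructor
  · intro h y
    have hy : y ∈ LinearMap.range M.mulVecLin := by
      rw [Submodule.eq_top_of_finrank_eq h]
      trivial
    exact hy
  · intro h
    have : LinearMap.range M.mulVecLin = ⊤ := LinearMap.range_eq_top.2 h
    rw [this, finrank_top]

theorem FullRowRank.leftRegular {p n : Type*} [Fintype p] [Fintype n] {F G : Matrix p n ℂ}
    (h : FullRowRank F G) : LeftRegular F G := by
  intro μ ν hc z hz
  obtain ⟨a, ha⟩ := (rank_eq_card_iff_forall_exists_mulVec_eq _).1 (h μ ν hc) (star z)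
  rw [← dotProduct_self_star_eq_zero, ← ha, dotProduct_mulVec, hz, zero_dotProduct]

/-- A covector that vanishes on the kernel of a matrix is a combination of its rows. -/
theorem exists_vecMul_eq_of_forall_dotProduct_eq_zero {p n : Type*} [Fintype p] [Fintype n]
    (M : Matrix p n ℂ) (c : n → ℂ) (h : ∀ a, M *ᵥ a = 0 → c ⬝ᵥ a = 0) :
    ∃ z, z ᵥ* M = c := by
  classical
  have hmem : dotProductBilin ℂ ℂ c ∈ (LinearMap.ker M.mulVecLin).dualAnnihilator := by
    rw [Submodule.mem_dualAnnihilator]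
    intro a ha
    exact h a (by simpa using ha)
  rw [← LinearMap.range_dualMap_eq_dualAnnihilator_ker] at hmem
  obtain ⟨ψ, hψ⟩ := hmem
  refine ⟨fun i => ψ (Pi.single i 1), ?_⟩
  have key : ∀ y : p → ℂ, ψ y = (fun i => ψ (Pi.single i 1)) ⬝ᵥ y := by
    intro y
    rw [pi_eq_sum_univ' y, map_sum, ← pi_eq_sum_univ' y, dotProduct]
    exact Finset.sum_congr rfl fun i _ => by rw [map_smul, smul_eq_mul, mul_comm]
  ext j
  have h2 : ((fun i => ψ (Pi.single i 1)) ᵥ* M) ⬝ᵥ Pi.single j 1 = c ⬝ᵥ Pi.single j 1 := by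
    rw [← dotProduct_mulVec, ← key]
    exact LinearMap.congr_fun hψ (Pi.single j 1)
  simpa only [dotProduct_single, mul_one] using h2

open Filter in
/-- For a pencil of full row rank, the kernels of `F - t G`, `t` real and large, span. -/
theorem eq_zero_of_eventually_dotProduct_eq_zero {p n : Type*} [Fintype p] [Fintype n]
    {F G : Matrix p n ℂ} (hreg : LeftRegular F G) (c : n → ℂ)
    (hc : ∀ᶠ t : ℝ in atTop, ∀ a, (F - (t : ℂ) • G) *ᵥ a = 0 → c ⬝ᵥ a = 0) : c = 0 := by
  classical
  -- The covectors that eventually vanish on the kernels form a space `V`. An endomorphism of `V`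
  -- without eigenvectors will show that it is zero.
  let V : Submodule ℂ (n → ℂ) :=
    { carrier := {c | ∀ᶠ t : ℝ in atTop, ∀ a, (F - (t : ℂ) • G) *ᵥ a = 0 → c ⬝ᵥ a = 0}
      add_mem' := by
        intro x y hx hy
        filter_upwards [hx, hy] with t h1 h2 a ha
        rw [add_dotProduct, h1 a ha, h2 a ha, add_zero]
      zero_mem' := by simp
      smul_mem' := by
        intro r x hx
        filter_upwards [hx] with t h1 a ha
        rw [smul_dotProduct, h1 a ha, smul_zero] }
  -- Finite dimension gives one threshold for all of `V`.
  have hall : ∀ᶠ t : ℝ in atTop, ∀ c ∈ V, ∀ a, (F - (t : ℂ) • G) *ᵥ a = 0 → c ⬝ᵥ a = 0 := by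
    let b := Module.finBasis ℂ V
    have hb : ∀ᶠ t : ℝ in atTop, ∀ i, ∀ a, (F - (t : ℂ) • G) *ᵥ a = 0 →
        (b i : n → ℂ) ⬝ᵥ a = 0 := eventually_all.2 fun i => (b i).2
    filter_upwards [hb] with t ht c hcV a ha
    have := congrArg Subtype.val (b.sum_repr ⟨c, hcV⟩)
    simp only [Submodule.coe_sum, Submodule.coe_smul] at this
    rw [← this, sum_dotProduct]
    exact Finset.sum_eq_zero fun i _ => by rw [smul_dotProduct, ht i a ha, smul_zero]
  obtain ⟨t, ht⟩ := hall.exists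
  let L : (p → ℂ) →ₗ[ℂ] (n → ℂ) := (F - (t : ℂ) • G).vecMulLinear
  have hL : Function.Injective L := by
    rw [← LinearMap.ker_eq_bot, LinearMap.ker_eq_bot']
    intro z hz
    refine hreg (-t) (-1) (by simp) z ?_
    rw [← hz]
    simp only [L, vecMulLinear_apply]
    congr 1
    module
  obtain ⟨g, hg⟩ := LinearMap.exists_leftInverse_of_injective L (LinearMap.ker_eq_bot.2 hL)
  have hgL : ∀ z, g (L z) = z := fun z => LinearMap.congr_fun hg z
  have hz : ∀ c ∈ V, L (g c) = c := by
    intro c hcV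
    obtain ⟨z, hz⟩ := exists_vecMul_eq_of_forall_dotProduct_eq_zero _ c (ht c hcV)
    have : L z = c := hz
    rw [← this, hgL]
  -- If `c = z (F - t G)` and `F a = t' G a`, then `c a = (t' - t) z G a`; so `z G` vanishes
  -- wherever `c` does, once `t' ≠ t`.
  have hmaps : ∀ c ∈ V, (G.vecMulLinear ∘ₗ g) c ∈ V := by
    intro c hcV
    have hc' : ∀ᶠ t : ℝ in atTop, ∀ a, (F - (t : ℂ) • G) *ᵥ a = 0 → c ⬝ᵥ a = 0 := hcV
    change ∀ᶠ t : ℝ in atTop, ∀ a, (F - (t : ℂ) • G) *ᵥ a = 0 → (g c ᵥ* G) ⬝ᵥ a = 0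
    filter_upwards [hc', eventually_ne_atTop t] with t' h1 hne a ha
    have h2 := h1 a ha
    have hFa : F *ᵥ a = (t' : ℂ) • G *ᵥ a := by
      rw [sub_mulVec, smul_mulVec, sub_eq_zero] at ha
      exact ha
    have h3 : (g c ᵥ* (F - (t : ℂ) • G)) ⬝ᵥ a = 0 := by
      have : g c ᵥ* (F - (t : ℂ) • G) = c := hz c hcV
      rw [this, h2]
    rw [← dotProduct_mulVec, sub_mulVec, smul_mulVec, hFa, ← sub_smul, dotProduct_smul,
      smul_eq_mul, dotProduct_mulVec] at h3
    refine (mul_eq_zero.1 h3).resolve_left ?_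
    rw [← ne_eq, sub_ne_zero]
    exact_mod_cast hne
  let T : Module.End ℂ V := (G.vecMulLinear ∘ₗ g).restrict hmaps
  by_contra hne
  have : Nontrivial V := ⟨⟨⟨c, hc⟩, 0, fun h => hne (congrArg Subtype.val h)⟩⟩
  -- An eigenvector satisfies `z G = κ z (F - t G)`, a left null vector of the pencil at `(1 + κ t,
  -- κ)`.
  obtain ⟨κ, hκ⟩ := Module.End.exists_eigenvalue T
  obtain ⟨v, hv⟩ := hκ.exists_hasEigenvector
  have hTv := congrArg Subtype.val hv.apply_eq_smul
  have hTv' : g v ᵥ* G = κ • (v : n → ℂ) := hTv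
  have hv' : g v ᵥ* (F - (t : ℂ) • G) = v := hz v v.2
  have hgv : g v = 0 := by
    refine hreg (1 + κ * t) κ ?_ (g v) ?_
    · intro h
      simp only [Prod.mk_eq_zero] at h
      simp [h.2] at h
    · have h0 : g v ᵥ* G - κ • g v ᵥ* (F - (t : ℂ) • G) = 0 := by rw [hTv', hv', sub_self]
      rw [← h0, vecMul_sub, vecMul_sub, vecMul_smul, vecMul_smul, vecMul_smul]
      module
  apply hv.2
  ext1
  rw [← hv', hgv]
  simp

/-! ### Linear images of closed cones -/

theorem isClosed_image_cone {V W : Type*} [NormedAddCommGroup V] [NormedSpace ℝ V]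
    [FiniteDimensional ℝ V] [NormedAddCommGroup W] [NormedSpace ℝ W] (L : V →L[ℝ] W) {C : Set V}
    (hC : IsClosed C) (hsmul : ∀ r : ℝ, 0 ≤ r → ∀ x ∈ C, r • x ∈ C)
    (hker : ∀ x ∈ C, L x = 0 → x = 0) : IsClosed (L '' C) := by
  have := FiniteDimensional.proper_real V
  -- By homogeneity `δ` may be the minimum of `‖L x‖` over the compact unit part of the cone,
  -- positive because the kernel meets the cone only at zero.
  obtain ⟨δ, hδ, hbound⟩ : ∃ δ : ℝ, 0 < δ ∧ ∀ x ∈ C, δ * ‖x‖ ≤ ‖L x‖ := by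
    have hK : IsCompact (Metric.sphere (0 : V) 1 ∩ C) := (isCompact_sphere 0 1).inter_right hC
    have key : ∀ δ : ℝ, (∀ x ∈ Metric.sphere (0 : V) 1 ∩ C, δ ≤ ‖L x‖) →
        ∀ x ∈ C, δ * ‖x‖ ≤ ‖L x‖ := by
      intro δ h x hx
      rcases eq_or_ne x 0 with rfl | hx0
      · simp
      have hn : 0 < ‖x‖ := norm_pos_iff.2 hx0
      have := h (‖x‖⁻¹ • x) ⟨by simp [norm_smul, hn.ne'], hsmul _ (by positivity) x hx⟩
      rw [map_smul, norm_smul, norm_inv, norm_norm] at this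
      rwa [← le_div_iff₀ hn, div_eq_inv_mul]
    rcases (Metric.sphere (0 : V) 1 ∩ C).eq_empty_or_nonempty with he | hne
    · exact ⟨1, one_pos, key 1 (by simp [he])⟩
    · obtain ⟨x, hx, hmin⟩ := hK.exists_isMinOn hne L.continuous.norm.continuousOn
      refine ⟨‖L x‖, norm_pos_iff.2 fun h => ?_, key _ fun y hy => hmin hy⟩
      have := hx.1
      rw [hker x hx.2 h] at this
      simp at this
  refine isClosed_of_closure_subset fun y hy => ?_
  have h1 : y ∈ closure (Metric.ball y 1 ∩ L '' C) :=
    Metric.isOpen_ball.inter_closure ⟨Metric.mem_ball_self one_pos, hy⟩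
  -- Images close to `y` come from a bounded, hence compact, piece of the cone.
  have h2 : Metric.ball y 1 ∩ L '' C ⊆ L '' (C ∩ Metric.closedBall 0 ((‖y‖ + 1) / δ)) := by
    rintro _ ⟨hz, x, hx, rfl⟩
    refine ⟨x, ⟨hx, ?_⟩, rfl⟩
    rw [mem_closedBall_zero_iff, le_div_iff₀ hδ, mul_comm]
    refine (hbound x hx).trans ?_
    have := norm_sub_norm_le (L x) y
    rw [Metric.mem_ball, dist_eq_norm] at hz
    linarith
  have h3 : IsClosed (L '' (C ∩ Metric.closedBall 0 ((‖y‖ + 1) / δ))) :=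
    (((isCompact_closedBall _ _).inter_left hC).image L.continuous).isClosed
  exact Set.image_mono Set.inter_subset_left (h3.closure_subset_iff.2 h2 h1)

/-! ### Trace duality and decomposition into dyads -/

section

variable {p n : Type*} [Fintype p] [Fintype n]

theorem posSemidef_iff_re_nonneg {M : Matrix n n ℂ} :
    M.PosSemidef ↔ M.IsHermitian ∧ ∀ x, 0 ≤ (star x ⬝ᵥ M *ᵥ x).re := by
  refine ⟨fun h => ⟨h.isHermitian, fun x => h.re_dotProduct_nonneg x⟩, fun ⟨h1, h2⟩ => ?_⟩
  refine PosSemidef.of_dotProduct_mulVec_nonneg h1 fun x => ?_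
  rw [Complex.nonneg_iff]
  exact ⟨h2 x, (h1.im_star_dotProduct_mulVec_self x).symm⟩

theorem isClosed_isHermitian {n : Type*} : IsClosed {M : Matrix n n ℂ | M.IsHermitian} :=
  isClosed_eq (by fun_prop) continuous_id

theorem isClosed_posSemidef : IsClosed {M : Matrix n n ℂ | M.PosSemidef} := by
  simp only [posSemidef_iff_re_nonneg, Set.ofPred_and, Set.ofPred_forall]
  refine isClosed_isHermitian.inter (isClosed_iInter fun x => isClosed_le continuous_const ?_)
  fun_prop

theorem trace_mul_vecMulVec (X : Matrix n n ℂ) (v w : n → ℂ) :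
    (X * vecMulVec v w).trace = w ⬝ᵥ X *ᵥ v := by
  rw [mul_vecMulVec, trace_vecMulVec, dotProduct_comm]

/-- Every real functional on the Hermitian matrices is a trace pairing. -/
theorem exists_trace_representation (f : Matrix n n ℂ →ₗ[ℝ] ℝ) :
    ∃ X : Matrix n n ℂ, X.IsHermitian ∧
      ∀ H : Matrix n n ℂ, H.IsHermitian → f H = (X * H).trace.re := by
  classical
  -- Chosen so that the value of `f` at `z` times the `(i, j)` matrix unit is `Re (Y j i * z)`.
  let Y : Matrix n n ℂ := Matrix.of fun j i =>
    (f (Matrix.single i j 1) : ℂ) - Complex.I * f (Matrix.single i j Complex.I)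
  have hY : ∀ H, f H = (Y * H).trace.re := by
    intro H
    have h1 : ∀ i j, f (Matrix.single i j (H i j)) = (Y j i * H i j).re := by
      intro i j
      have : Matrix.single i j (H i j) = (H i j).re • Matrix.single i j (1 : ℂ)
          + (H i j).im • Matrix.single i j Complex.I := by
        rw [smul_single, smul_single, ← single_add]
        congr 1
        simp [Complex.re_add_im]
      rw [this, map_add, map_smul, map_smul]
      simp [Y]
      ring
    conv_lhs => rw [matrix_eq_sum_single H]
    simp only [map_sum, h1, trace, diag_apply, mul_apply, Complex.re_sum]
    exact Finset.sum_comm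
  -- Against Hermitian matrices only the Hermitian part of `Y` is seen.
  refine ⟨(1 / 2 : ℝ) • (Y + Yᴴ), ?_, fun H hH => ?_⟩
  · ext i j
    simp [add_comm]
  · have h2 : (Yᴴ * H).trace.re = (Y * H).trace.re := by
      have : Yᴴ * H = (H * Y)ᴴ := by rw [conjTranspose_mul, hH.eq]
      rw [this, trace_conjTranspose, trace_mul_comm]
      simp
    rw [smul_mul, trace_smul, add_mul, trace_add, Complex.smul_re, Complex.add_re, h2, hY, smul_eq_mul]
    ring

/-- Each row of `N` is a covector vanishing on the spanning kernels. -/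
theorem eq_zero_of_mulVec_kernel {k : Type*} {F G : Matrix p n ℂ} (hreg : LeftRegular F G)
    (N : Matrix k n ℂ)
    (h : ∀ t : ℝ, 0 < t → ∀ a, F *ᵥ a = (t : ℂ) • G *ᵥ a → N *ᵥ a = 0) : N = 0 := by
  refine funext fun i => ?_
  refine eq_zero_of_eventually_dotProduct_eq_zero hreg (N i) ?_
  filter_upwards [Filter.eventually_gt_atTop 0] with t ht a ha
  rw [sub_mulVec, smul_mulVec, sub_eq_zero] at ha
  exact congrFun (h t ht a ha) i

theorem LeftRegular.eq_zero_of_mul_eq_zero {k n : Type*} {F G : Matrix p n ℂ}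
    (hreg : LeftRegular F G) {N : Matrix k p ℂ} (h : N * G = 0) : N = 0 := by
  refine funext fun i => ?_
  refine hreg 1 0 (by simp) (N i) ?_
  simp only [one_smul, zero_smul, sub_zero]
  exact congrFun h i

/-- A sum `X` of dyads on the open half-line for which `F X Gᴴ` is positive definite. -/
theorem exists_posSemidef_posDef {F G : Matrix p n ℂ} (hreg : LeftRegular F G) :
    ∃ X : Matrix n n ℂ, X.PosSemidef ∧ (F * X * Gᴴ).PosDef := by
  classical
  -- Finitely many kernel vectors with the same span suffice; each contributes `F a aᴴ Gᴴ = t (G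
  -- a)(G a)ᴴ`. A null vector `z` of the sum makes `zᴴ G` vanish on all the kernels, so `zᴴ G = 0`.
  obtain ⟨b, hb, hspan, hli⟩ := exists_linearIndependent ℂ
    {a : n → ℂ | ∃ t : ℝ, 0 < t ∧ F *ᵥ a = (t : ℂ) • G *ᵥ a}
  have hfin : b.Finite := hli.setFinite
  have := hfin.fintype
  choose t ht hFt using fun a : b => hb a.2
  have hS : F * (∑ a : b, vecMulVec (a : n → ℂ) (star (a : n → ℂ))) * Gᴴ
      = ∑ a : b, (t a : ℂ) • vecMulVec (G *ᵥ (a : n → ℂ)) (star (G *ᵥ (a : n → ℂ))) := by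
    rw [Matrix.mul_sum, Matrix.sum_mul]
    refine Finset.sum_congr rfl fun a _ => ?_
    rw [mul_vecMulVec, vecMulVec_mul, hFt, smul_vecMulVec, star_mulVec]
  refine ⟨∑ a : b, vecMulVec (a : n → ℂ) (star (a : n → ℂ)),
    posSemidef_sum _ fun a _ => posSemidef_vecMulVec_self_star _, ?_⟩
  rw [hS]
  have hpsd : ∀ a : b, ((t a : ℂ) • vecMulVec (G *ᵥ (a : n → ℂ))
      (star (G *ᵥ (a : n → ℂ)))).PosSemidef := fun a =>
    (posSemidef_vecMulVec_self_star _).smul (by exact_mod_cast (ht a).le)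
  have hpsd' := posSemidef_sum Finset.univ fun a _ => hpsd a
  refine PosDef.of_dotProduct_mulVec_pos hpsd'.isHermitian fun z hz => ?_
  refine lt_of_le_of_ne (hpsd'.dotProduct_mulVec_nonneg z) fun h0 => hz ?_
  rw [sum_mulVec, dotProduct_sum, eq_comm,
    Finset.sum_eq_zero_iff_of_nonneg fun a _ => (hpsd a).dotProduct_mulVec_nonneg z] at h0
  have h1 : ∀ a ∈ b, (star z ᵥ* G) ⬝ᵥ a = 0 := by
    intro a ha
    have := h0 ⟨a, ha⟩ (Finset.mem_univ _)
    rw [smul_mulVec, dotProduct_smul, vecMulVec_mulVec] at this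
    have h2 : (t ⟨a, ha⟩ : ℂ) ≠ 0 := by exact_mod_cast (ht ⟨a, ha⟩).ne'
    rw [smul_eq_zero, or_iff_right h2] at this
    rw [← dotProduct_mulVec]
    have h3 : star (G *ᵥ a) ⬝ᵥ z = star (star z ⬝ᵥ G *ᵥ a) := by
      rw [star_dotProduct]
    rw [dotProduct_smul, h3] at this
    simpa using this
  have h4 : replicateRow Unit (star z ᵥ* G) = 0 := by
    refine eq_zero_of_mulVec_kernel hreg _ fun t ht a ha => ?_
    have hmem : a ∈ Submodule.span ℂ b := hspan ▸ Submodule.subset_span ⟨t, ht, ha⟩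
    have : b ⊆ LinearMap.ker (dotProductBilin ℂ ℂ (star z ᵥ* G)) := h1
    have := Submodule.span_le.2 this hmem
    ext
    exact this
  have h5 : star z = 0 := by
    refine hreg 1 0 (by simp) _ ?_
    simp only [one_smul, zero_smul, sub_zero]
    ext j
    exact congrFun (congrFun h4 ()) j
  simpa using h5

/-- If `F X Gᴴ` is Hermitian and invertible, then `X` is a sum of dyads `a aᴴ` with
`F a = t G a`, `t` real, so that its trace pairing with `M` is nonnegative. -/
theorem trace_mul_nonneg_of_isUnit [DecidableEq p] (half : Prop) {F G : Matrix p n ℂ}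
    {M : Matrix n n ℂ}
    (hM : ∀ t : ℝ, (half → 0 ≤ t) → ∀ a, F *ᵥ a = (t : ℂ) • G *ᵥ a → 0 ≤ (star a ⬝ᵥ M *ᵥ a).re)
    {X : Matrix n n ℂ} (hX : X.PosSemidef) (hN : (F * X * Gᴴ).IsHermitian)
    (hpos : half → (F * X * Gᴴ).PosSemidef) (hu : IsUnit (F * X * Gᴴ).det) :
    0 ≤ (M * X).trace.re := by
  obtain ⟨r, v, hv⟩ := posSemidef_iff_eq_sum_vecMulVec.1 hX
  let V : Matrix n (Fin r) ℂ := Matrix.of fun i k => v k i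
  have hV : X = V * Vᴴ := by
    rw [hv]
    ext i j
    simp [V, mul_apply, Matrix.sum_apply, vecMulVec_apply]
  set N := F * X * Gᴴ with hNdef
  have hUW : F * V * (G * V)ᴴ = N := by
    rw [hNdef, hV, conjTranspose_mul]
    simp only [Matrix.mul_assoc]
  have hWU : G * V * (F * V)ᴴ = N := by
    rw [← hN.eq, ← hUW, conjTranspose_mul _ (G * V)ᴴ, conjTranspose_conjTranspose]
  -- A Hermitian solution of `G V Λ = F V`: an eigenvector `q` with eigenvalue `t` gives `F (V q) =
  -- t G (V q)`.
  set Λ := (F * V)ᴴ * N⁻¹ * (F * V) with hΛdef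
  have hΛ : Λ.IsHermitian := isHermitian_conjTranspose_mul_mul _ hN.inv
  have hWΛ : G * V * Λ = F * V := by
    rw [hΛdef, ← Matrix.mul_assoc (G * V), ← Matrix.mul_assoc (G * V), hWU,
      mul_nonsing_inv _ hu, Matrix.one_mul]
  have heig : half → ∀ j, 0 ≤ hΛ.eigenvalues j := by
    intro h
    have : Λ.PosSemidef := (hpos h).inv.conjTranspose_mul_mul_same (F * V)
    exact this.eigenvalues_nonneg
  let q : Fin r → Fin r → ℂ := fun j => ⇑(hΛ.eigenvectorBasis j)
  have hq : ∀ j, 0 ≤ (star (V *ᵥ q j) ⬝ᵥ M *ᵥ (V *ᵥ q j)).re := by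
    intro j
    refine hM (hΛ.eigenvalues j) (fun h => heig h j) _ ?_
    rw [mulVec_mulVec, mulVec_mulVec, ← hWΛ, ← mulVec_mulVec, hΛ.mulVec_eigenvectorBasis j,
      mulVec_smul]
    rfl
  -- `X = (V U)(V U)ᴴ` for every unitary `U`; the eigenvector unitary makes the columns of `V U` the
  -- vectors `V q`.
  have htr : (M * X).trace = ∑ j, star (V *ᵥ q j) ⬝ᵥ M *ᵥ (V *ᵥ q j) := by
    let U : Matrix (Fin r) (Fin r) ℂ := hΛ.eigenvectorUnitary
    have hU : U * Uᴴ = 1 := Unitary.mul_star_self_of_mem hΛ.eigenvectorUnitary.2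
    have hVU : V * U * (V * U)ᴴ = X := by
      rw [conjTranspose_mul, Matrix.mul_assoc, ← Matrix.mul_assoc U, hU, Matrix.one_mul, hV]
    have : (M * X).trace = ((V * U)ᴴ * M * (V * U)).trace := by
      rw [trace_mul_comm ((V * U)ᴴ * M), ← Matrix.mul_assoc, hVU, trace_mul_comm]
    rw [this, trace]
    refine Finset.sum_congr rfl fun j _ => ?_
    have hcol : (V * U).col j = V *ᵥ q j := by
      ext i
      rfl
    rw [diag_apply, Matrix.mul_assoc, mul_apply', ← hcol]
    rfl
  rw [htr, Complex.re_sum]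
  exact Finset.sum_nonneg fun j _ => hq j

end

/-! ### The Kalman-Yakubovich-Popov lemma on the real line, by duality -/

section

variable {p n : Type*} [Fintype p] [Fintype n]

/-- The Hermitian-matrix-valued map whose image of the cone of `(T, P, Q)`, `T` and `Q` positive
semidefinite, consists of the certified matrices of the pencil on the real line. -/
def certificateMap (F G : Matrix p n ℂ) :
    (Matrix n n ℂ × Matrix p p ℂ × Matrix p p ℂ) →ₗ[ℝ] Matrix n n ℂ where
  toFun x := x.1 - Complex.I • (Fᴴ * x.2.1 * G - Gᴴ * x.2.1 * F)
    + (Fᴴ * x.2.2 * G + Gᴴ * x.2.2 * F)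
  map_add' x y := by
    simp only [Prod.fst_add, Prod.snd_add, Matrix.mul_add, Matrix.add_mul]
    module
  map_smul' r x := by
    simp only [Prod.smul_fst, Prod.smul_snd, Matrix.mul_smul, Matrix.smul_mul, RingHom.id_apply]
    module

/-- The cone of the multipliers `(T, P, Q)`; on the whole line `Q = 0`. -/
def certificateCone (half : Prop) (p n : Type*) :
    Set (Matrix n n ℂ × Matrix p p ℂ × Matrix p p ℂ) :=
  {x | x.1.PosSemidef ∧ x.2.1.IsHermitian ∧ x.2.2.PosSemidef ∧ (¬ half → x.2.2 = 0)}

theorem smul_mem_certificateCone {half : Prop} {p n : Type*} {r : ℝ} (hr : 0 ≤ r)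
    {x : Matrix n n ℂ × Matrix p p ℂ × Matrix p p ℂ} (hx : x ∈ certificateCone half p n) :
    r • x ∈ certificateCone half p n := by
  refine ⟨hx.1.smul hr, ?_, hx.2.2.1.smul hr, fun h => ?_⟩
  · exact IsSelfAdjoint.smul (IsSelfAdjoint.all r) hx.2.1
  · simp [hx.2.2.2 h]

theorem add_mem_certificateCone {half : Prop} {p n : Type*}
    {x y : Matrix n n ℂ × Matrix p p ℂ × Matrix p p ℂ} (hx : x ∈ certificateCone half p n)
    (hy : y ∈ certificateCone half p n) : x + y ∈ certificateCone half p n := by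
  refine ⟨hx.1.add hy.1, hx.2.1.add hy.2.1, hx.2.2.1.add hy.2.2.1, fun h => ?_⟩
  simp [hx.2.2.2 h, hy.2.2.2 h]

theorem isClosed_certificateCone (half : Prop) : IsClosed (certificateCone half p n) := by
  refine (isClosed_posSemidef.preimage continuous_fst).inter
    ((isClosed_isHermitian.preimage (continuous_fst.comp continuous_snd)).inter
    ((isClosed_posSemidef.preimage (continuous_snd.comp continuous_snd)).inter ?_))
  by_cases h : half
  · simp only [h, not_true_eq_false, false_imp_iff]
    exact isClosed_univ
  · simp only [h, not_false_eq_true, true_imp_iff]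
    exact isClosed_eq (continuous_snd.comp continuous_snd) continuous_const

theorem isHermitian_certificateMap {half : Prop} {n : Type*} (F G : Matrix p n ℂ)
    {x : Matrix n n ℂ × Matrix p p ℂ × Matrix p p ℂ} (hx : x ∈ certificateCone half p n) :
    (certificateMap F G x).IsHermitian := by
  obtain ⟨h1, h2, h3, -⟩ := hx
  change (x.1 - Complex.I • (Fᴴ * x.2.1 * G - Gᴴ * x.2.1 * F)
    + (Fᴴ * x.2.2 * G + Gᴴ * x.2.2 * F))ᴴ = _
  simp only [conjTranspose_add, conjTranspose_sub, conjTranspose_smul, conjTranspose_mul,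
    conjTranspose_conjTranspose, h1.isHermitian.eq, h2.eq, h3.isHermitian.eq, certificateMap,
    LinearMap.coe_mk, AddHom.coe_mk, Complex.star_def, Complex.conj_I, Matrix.mul_assoc]
  module

theorem star_dotProduct_mul_mul_mulVec (F G : Matrix p n ℂ) (P : Matrix p p ℂ) (a : n → ℂ) :
    star a ⬝ᵥ (Fᴴ * P * G) *ᵥ a = star (F *ᵥ a) ⬝ᵥ P *ᵥ (G *ᵥ a) := by
  rw [star_mulVec, ← mulVec_mulVec, ← mulVec_mulVec, dotProduct_mulVec _ Fᴴ]

/-- This is the kernel condition that makes the cone of certified matrices closed. Where `F a = t G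
a` with `t > 0`, the `P` terms cancel and the nonnegative `T` and `Q` terms must vanish separately;
since such `a` span, `T` and `Q` are zero. -/
theorem eq_zero_of_certificateMap_eq_zero {half : Prop} {F G : Matrix p n ℂ}
    (hreg : LeftRegular F G) {x : Matrix n n ℂ × Matrix p p ℂ × Matrix p p ℂ}
    (hx : x ∈ certificateCone half p n) (h0 : certificateMap F G x = 0) : x = 0 := by
  classical
  obtain ⟨T, P, Q⟩ := x
  obtain ⟨hT, hP, hQ, -⟩ := hx
  simp only at hT hP hQ
  replace h0 : T - Complex.I • (Fᴴ * P * G - Gᴴ * P * F) + (Fᴴ * Q * G + Gᴴ * Q * F) = 0 := h0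
  have hform : ∀ t : ℝ, ∀ a, F *ᵥ a = (t : ℂ) • G *ᵥ a →
      star a ⬝ᵥ T *ᵥ a + 2 * t * (star (G *ᵥ a) ⬝ᵥ Q *ᵥ (G *ᵥ a)) = 0 := by
    intro t a ha
    have h1 := congrArg (fun N => star a ⬝ᵥ N *ᵥ a) h0
    simp only [add_mulVec, sub_mulVec, smul_mulVec, dotProduct_add, dotProduct_sub,
      dotProduct_smul, star_dotProduct_mul_mul_mulVec, ha, star_smul, mulVec_smul, smul_dotProduct,
      zero_mulVec, dotProduct_zero, Complex.star_def, Complex.conj_ofReal, smul_eq_mul] at h1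
    linear_combination h1
  have hzero : ∀ t : ℝ, 0 < t → ∀ a, F *ᵥ a = (t : ℂ) • G *ᵥ a →
      T *ᵥ a = 0 ∧ (Q * G) *ᵥ a = 0 := by
    intro t ht a ha
    have h1 := hT.dotProduct_mulVec_nonneg a
    have h2 := hQ.dotProduct_mulVec_nonneg (G *ᵥ a)
    have ht' : (0 : ℂ) < 2 * t := by
      have : (0 : ℂ) < t := by exact_mod_cast ht
      positivity
    have h3 := (add_eq_zero_iff_of_nonneg h1 (mul_nonneg ht'.le h2)).1 (hform t a ha)
    refine ⟨(hT.dotProduct_mulVec_zero_iff a).1 h3.1, ?_⟩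
    rw [← mulVec_mulVec]
    exact (hQ.dotProduct_mulVec_zero_iff _).1 ((mul_eq_zero.1 h3.2).resolve_left ht'.ne')
  have hT0 : T = 0 := eq_zero_of_mulVec_kernel hreg T fun t ht a ha => (hzero t ht a ha).1
  have hQ0 : Q = 0 := hreg.eq_zero_of_mul_eq_zero
    (eq_zero_of_mulVec_kernel hreg (Q * G) fun t ht a ha => (hzero t ht a ha).2)
  -- What remains is `Fᴴ P G = Gᴴ P F`. On a kernel vector it reads `(F - t G)ᴴ (P G a) = 0`, and
  -- the pencil has trivial left kernel.
  have hP0 : P = 0 := by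
    rw [hT0, hQ0] at h0
    have h1 : Fᴴ * P * G = Gᴴ * P * F := by
      simpa [sub_eq_zero] using h0
    refine hreg.eq_zero_of_mul_eq_zero (eq_zero_of_mulVec_kernel hreg _ fun t ht a ha => ?_)
    have h2 := congrArg (fun N => N *ᵥ a) h1
    simp only [← mulVec_mulVec, ha, mulVec_smul] at h2
    rw [← mulVec_mulVec]
    refine star_eq_zero.1 (hreg (-t) (-1) (by simp) _ ?_)
    have h3 : (F - (t : ℂ) • G)ᴴ *ᵥ (P *ᵥ (G *ᵥ a)) = 0 := by
      rw [conjTranspose_sub, conjTranspose_smul, sub_mulVec, smul_mulVec, h2]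
      simp
    have h4 := congrArg star h3
    rw [star_mulVec, conjTranspose_conjTranspose, star_zero] at h4
    rw [← h4]
    congr 1
    module
  rw [hT0, hP0, hQ0]
  rfl

-- Closedness is what permits strict separation in `exists_certificate`. The choice of matrix norm
-- is immaterial.
open scoped Matrix.Norms.Elementwise in
theorem isClosed_image_certificateCone (half : Prop) {F G : Matrix p n ℂ}
    (hreg : LeftRegular F G) : IsClosed (certificateMap F G '' certificateCone half p n) :=
  isClosed_image_cone (LinearMap.toContinuousLinearMap (certificateMap F G))
    (isClosed_certificateCone half) (fun _ hr _ hx => smul_mem_certificateCone hr hx)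
    fun _ hx h0 => eq_zero_of_certificateMap_eq_zero hreg hx h0

/-- A Hermitian matrix outside a closed convex cone of Hermitian matrices is separated from it
by a trace pairing. -/
theorem exists_trace_separation {K : Set (Matrix n n ℂ)} (hK : IsClosed K)
    (hadd : ∀ x ∈ K, ∀ y ∈ K, x + y ∈ K) (hsmul : ∀ r : ℝ, 0 ≤ r → ∀ x ∈ K, r • x ∈ K)
    (hne : K.Nonempty) (hherm : ∀ x ∈ K, x.IsHermitian)
    {M : Matrix n n ℂ} (hM : M.IsHermitian) (hMK : M ∉ K) :
    ∃ X : Matrix n n ℂ, X.IsHermitian ∧ (∀ x ∈ K, 0 ≤ (X * x).trace.re) ∧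
      (X * M).trace.re < 0 := by
  have hconv : Convex ℝ K := fun x hx y hy a b ha hb _ =>
    hadd _ (hsmul a ha x hx) _ (hsmul b hb y hy)
  have : LocallyConvexSpace ℝ (Matrix n n ℂ) :=
    inferInstanceAs (LocallyConvexSpace ℝ (n → n → ℂ))
  obtain ⟨f, u, hfM, hfK⟩ := geometric_hahn_banach_point_closed hconv hK hMK
  obtain ⟨X, hX, hfX⟩ := exists_trace_representation f.toLinearMap
  replace hfX : ∀ H : Matrix n n ℂ, H.IsHermitian → f H = (X * H).trace.re := hfX
  obtain ⟨x₀, hx₀⟩ := hne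
  have hu : u < 0 := by
    have := hfK _ (hsmul 0 le_rfl x₀ hx₀)
    simpa using this
  refine ⟨X, hX, fun x hx => ?_, ?_⟩
  · rw [← hfX x (hherm x hx)]
    -- If `f x < 0`, the nonnegative multiple of `x` by `u / f x` lies in `K` and has value exactly
    -- `u`, which is excluded.
    by_contra! hlt
    have := hfK _ (hsmul (u / f x) (div_nonneg_of_nonpos hu.le hlt.le) x hx)
    rw [map_smul, smul_eq_mul, div_mul_cancel₀ _ hlt.ne] at this
    exact lt_irrefl _ this
  · rw [← hfX M hM]
    linarith

-- The sum is `N₀ (ε - (-N₀⁻¹ N))`, singular only when `ε` is one of finitely many eigenvalues.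
open Filter Topology in
theorem eventually_isUnit_det_add_smul [DecidableEq p] (N N₀ : Matrix p p ℂ) (hN₀ : IsUnit N₀.det) :
    ∀ᶠ ε : ℝ in 𝓝[>] 0, IsUnit (N + (ε : ℂ) • N₀).det := by
  have hroots : {z : ℂ | (-(N₀⁻¹ * N)).charpoly.IsRoot z}.Finite :=
    Polynomial.finite_setOfPred_isRoot (charpoly_monic _).ne_zero
  have h1 : ∀ᶠ ε : ℝ in 𝓝[>] 0, (ε : ℂ) ∉ {z : ℂ | (-(N₀⁻¹ * N)).charpoly.IsRoot z} := by
    have h2 : ∀ᶠ ε : ℝ in cofinite, (ε : ℂ) ∉ {z : ℂ | (-(N₀⁻¹ * N)).charpoly.IsRoot z} :=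
      (hroots.preimage Complex.ofReal_injective.injOn).eventually_cofinite_notMem
    exact h2.filter_mono ((nhdsGT_le_nhdsNE 0).trans (nhdsNE_le_cofinite 0))
  filter_upwards [h1] with ε hε
  have h3 : N + (ε : ℂ) • N₀ = N₀ * (scalar p (ε : ℂ) - (-(N₀⁻¹ * N))) := by
    rw [sub_neg_eq_add, Matrix.mul_add, ← Matrix.mul_assoc, mul_nonsing_inv _ hN₀, Matrix.one_mul,
      add_comm, scalar_apply, ← smul_one_eq_diagonal, Matrix.mul_smul, Matrix.mul_one]
  rw [h3, det_mul]
  refine hN₀.mul (isUnit_iff_ne_zero.2 ?_)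
  rw [← eval_charpoly]
  exact hε

open Filter Topology in
/-- The Kalman-Yakubovich-Popov lemma for a pencil of full row rank, on the real line or on the
half-line of nonnegative real numbers. -/
theorem exists_certificate (half : Prop) {F G : Matrix p n ℂ} (hreg : LeftRegular F G)
    {M : Matrix n n ℂ} (hM : M.IsHermitian)
    (hpos : ∀ t : ℝ, (half → 0 ≤ t) → ∀ a, F *ᵥ a = (t : ℂ) • G *ᵥ a →
      0 ≤ (star a ⬝ᵥ M *ᵥ a).re) :
    M ∈ certificateMap F G '' certificateCone half p n := by
  classical
  by_contra hMK
  obtain ⟨X, hX, hXK, hXM⟩ := exists_trace_separation (isClosed_image_certificateCone half hreg)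
    (by
      rintro _ ⟨x, hx, rfl⟩ _ ⟨y, hy, rfl⟩
      exact ⟨x + y, add_mem_certificateCone hx hy, map_add _ _ _⟩)
    (by
      rintro r hr _ ⟨x, hx, rfl⟩
      exact ⟨r • x, smul_mem_certificateCone hr hx, map_smul _ _ _⟩)
    ⟨_, 0, ⟨.zero, isHermitian_zero, .zero, fun _ => rfl⟩, rfl⟩
    (by
      rintro _ ⟨x, hx, rfl⟩
      exact isHermitian_certificateMap F G hx) hM hMK
  have hcone : ∀ T P Q, (T, P, Q) ∈ certificateCone half p n →
      0 ≤ (X * (T - Complex.I • (Fᴴ * P * G - Gᴴ * P * F)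
        + (Fᴴ * Q * G + Gᴴ * Q * F))).trace.re := fun T P Q h => hXK _ ⟨_, h, rfl⟩
  -- Testing the separating functional on `T`, `P` and `Q` in turn gives the three properties of
  -- `X`.
  have hXpsd : X.PosSemidef := by
    refine posSemidef_iff_re_nonneg.2 ⟨hX, fun v => ?_⟩
    have := hcone (vecMulVec v (star v)) 0 0
      ⟨posSemidef_vecMulVec_self_star v, isHermitian_zero, .zero, fun _ => rfl⟩
    simpa [trace_mul_vecMulVec] using this
  have hSstar : (F * X * Gᴴ)ᴴ = G * X * Fᴴ := by
    rw [conjTranspose_mul, conjTranspose_mul, conjTranspose_conjTranspose, hX.eq, Matrix.mul_assoc]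
  have hcyc : ∀ (A B : Matrix p n ℂ) (P : Matrix p p ℂ),
      (X * (Aᴴ * P * B)).trace = (B * X * Aᴴ * P).trace := by
    intro A B P
    rw [Matrix.mul_assoc Aᴴ, ← Matrix.mul_assoc X, ← Matrix.mul_assoc (X * Aᴴ), trace_mul_comm,
      ← Matrix.mul_assoc, ← Matrix.mul_assoc]
  have hS : (F * X * Gᴴ).IsHermitian := by
    set S := F * X * Gᴴ with hSdef
    -- As multiplier `P`, this Hermitian matrix gives the pairing `-tr(Dᴴ D)`, which is nonnegative
    -- only if `D = 0`.
    set D := Complex.I • (Sᴴ - S) with hD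
    have hDherm : Dᴴ = D := by
      rw [hD, conjTranspose_smul, conjTranspose_sub, conjTranspose_conjTranspose, Complex.star_def,
        Complex.conj_I]
      module
    have h1 := hcone 0 D 0 ⟨.zero, hDherm, .zero, fun _ => rfl⟩
    have h2 : (X * (0 - Complex.I • (Fᴴ * D * G - Gᴴ * D * F)
        + (Fᴴ * (0 : Matrix p p ℂ) * G + Gᴴ * (0 : Matrix p p ℂ) * F))).trace
        = - (Dᴴ * D).trace := by
      have : Dᴴ * D = Complex.I • (Sᴴ * D - S * D) := by
        rw [hDherm]
        conv_lhs => rw [hD]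
        rw [Matrix.smul_mul, Matrix.sub_mul]
      rw [this, hSstar]
      simp only [Matrix.mul_zero, Matrix.zero_mul, add_zero, zero_sub, Matrix.mul_neg, trace_neg,
        Matrix.mul_smul, trace_smul, Matrix.mul_sub, trace_sub, hcyc, hSdef]
    have h3 : (Dᴴ * D).trace = 0 := by
      have h4 := (posSemidef_conjTranspose_mul_self D).trace_nonneg
      rw [h2, Complex.neg_re] at h1
      rw [Complex.nonneg_iff] at h4
      exact Complex.ext (by simpa using le_antisymm (by linarith) h4.1) h4.2.symm
    rw [trace_conjTranspose_mul_self_eq_zero_iff, hD, smul_eq_zero,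
      or_iff_right Complex.I_ne_zero, sub_eq_zero] at h3
    exact h3
  have hSpos : half → (F * X * Gᴴ).PosSemidef := by
    intro h
    refine posSemidef_iff_re_nonneg.2 ⟨hS, fun z => ?_⟩
    have h1 := hcone 0 0 (vecMulVec z (star z))
      ⟨.zero, isHermitian_zero, posSemidef_vecMulVec_self_star z, fun h' => absurd h h'⟩
    simp only [Matrix.mul_zero, Matrix.zero_mul, sub_self, smul_zero, zero_add, Matrix.mul_add,
      trace_add, hcyc, ← hSstar, hS.eq, trace_mul_vecMulVec, Complex.add_re] at h1
    linarith
  -- `F X Gᴴ` may be singular. Adding `ε X₀` makes it invertible for all small `ε > 0` and keeps it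
  -- Hermitian (and positive semidefinite on the half-line); then `ε` tends to zero.
  obtain ⟨X₀, hX₀, hS₀⟩ := exists_posSemidef_posDef hreg
  have hlin : ∀ ε : ℝ, F * (X + (ε : ℂ) • X₀) * Gᴴ = F * X * Gᴴ + (ε : ℂ) • (F * X₀ * Gᴴ) := by
    intro ε
    simp only [Matrix.mul_add, Matrix.add_mul, Matrix.mul_smul, Matrix.smul_mul]
  have hev : ∀ᶠ ε : ℝ in 𝓝[>] 0, 0 ≤ (M * X).trace.re + ε * (M * X₀).trace.re := by
    filter_upwards [eventually_isUnit_det_add_smul (F * X * Gᴴ) (F * X₀ * Gᴴ)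
      ((isUnit_iff_isUnit_det _).1 hS₀.isUnit), self_mem_nhdsWithin] with ε hε hε0
    have hε0' : (0 : ℂ) ≤ ε := by exact_mod_cast (le_of_lt hε0)
    have hpsd₀ : ((ε : ℂ) • (F * X₀ * Gᴴ)).PosSemidef := hS₀.posSemidef.smul hε0'
    have := trace_mul_nonneg_of_isUnit half hpos (hXpsd.add (hX₀.smul hε0'))
      (by rw [hlin]; exact hS.add hpsd₀.isHermitian)
      (fun h => by rw [hlin]; exact (hSpos h).add hpsd₀) (by rw [hlin]; exact hε)
    simpa [Matrix.mul_add, trace_add, trace_smul] using this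
  have hlim : Tendsto (fun ε : ℝ => (M * X).trace.re + ε * (M * X₀).trace.re) (𝓝[>] 0)
      (𝓝 ((M * X).trace.re + 0 * (M * X₀).trace.re)) :=
    tendsto_nhdsWithin_of_tendsto_nhds (Continuous.tendsto (by fun_prop) 0)
  have := ge_of_tendsto hlim hev
  rw [zero_mul, add_zero, trace_mul_comm] at this
  linarith

end

/-! ### From general curves to the real line -/

section

universe u v

variable {p n : Type*} [Fintype p]

theorem quadForm_eq (Θ : Matrix (Fin 2) (Fin 2) ℂ) (μ ν : ℂ) : quadForm Θ μ ν =
    star μ * (Θ 0 0 * μ + Θ 0 1 * ν) + star ν * (Θ 1 0 * μ + Θ 1 1 * ν) := by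
  simp [quadForm, dotProduct, mulVec, Fin.sum_univ_two]

/-- The matrix `[F; G]ᴴ (Θ ⊗ P) [F; G]`, written out. -/
def pencilForm (Θ : Matrix (Fin 2) (Fin 2) ℂ) (F G : Matrix p n ℂ)
    (P : Matrix p p ℂ) : Matrix n n ℂ :=
  Θ 0 0 • (Fᴴ * P * F) + Θ 0 1 • (Fᴴ * P * G) + Θ 1 0 • (Gᴴ * P * F) + Θ 1 1 • (Gᴴ * P * G)

theorem stack_conjTranspose_mul_kronecker_mul (Θ : Matrix (Fin 2) (Fin 2) ℂ) (F G : Matrix p n ℂ)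
    (P : Matrix p p ℂ) : (stack F G)ᴴ * (Θ ⊗ₖ P) * stack F G = pencilForm Θ F G P := by
  ext i j
  simp only [pencilForm, mul_apply, stack, Fintype.sum_prod_type, Fin.sum_univ_two,
    conjTranspose_apply, of_apply, kroneckerMap_apply, Matrix.add_apply, Matrix.smul_apply,
    smul_eq_mul, Finset.mul_sum, Finset.sum_mul, add_mul, Finset.sum_add_distrib, cons_val_zero,
    cons_val_one]
  have key : ∀ (θ : ℂ) (A B : Matrix p n ℂ), ∑ x, ∑ y, star (A y i) * (θ * P y x) * B x j
      = ∑ x, ∑ y, θ * (star (A y i) * P y x * B x j) := fun θ A B =>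
    Finset.sum_congr rfl fun x _ => Finset.sum_congr rfl fun y _ => by ring
  simp only [key]
  ring

theorem pencilForm_zero (Θ : Matrix (Fin 2) (Fin 2) ℂ) (F G : Matrix p n ℂ) :
    pencilForm Θ F G 0 = 0 := by
  simp [pencilForm]

theorem star_dotProduct_pencilForm_mulVec [Fintype n] (Θ : Matrix (Fin 2) (Fin 2) ℂ) {F G : Matrix p n ℂ}
    (P : Matrix p p ℂ) {a : n → ℂ} {y : p → ℂ} {μ ν : ℂ} (hF : F *ᵥ a = μ • y)
    (hG : G *ᵥ a = ν • y) :
    star a ⬝ᵥ pencilForm Θ F G P *ᵥ a = quadForm Θ μ ν * (star y ⬝ᵥ P *ᵥ y) := by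
  simp only [pencilForm, add_mulVec, smul_mulVec, dotProduct_add, dotProduct_smul,
    star_dotProduct_mul_mul_mulVec, hF, hG, star_smul, mulVec_smul, smul_dotProduct, smul_eq_mul,
    quadForm_eq]
  ring

/-- The Kalman-Yakubovich-Popov property of a curve: a Hermitian matrix that is nonnegative on
the set `dict Φ Ψ F G` of a pencil of full row rank has a certificate `(P, Q)`. -/
def KYPProperty (Φ Ψ : Matrix (Fin 2) (Fin 2) ℂ) : Prop :=
  ∀ (p : Type u) (n : Type v) [Fintype p] [Fintype n] (F G : Matrix p n ℂ), LeftRegular F G →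
    ∀ M : Matrix n n ℂ, M.IsHermitian →
      (∀ a ∈ dict Φ Ψ F G, 0 ≤ (star a ⬝ᵥ M *ᵥ a).re) →
      ∃ P Q : Matrix p p ℂ, P.IsHermitian ∧ Q.PosSemidef ∧
        (M + pencilForm Φ F G P + pencilForm Ψ F G Q).PosSemidef

/-- The normal forms below live on the extended real line; their finite points are enough to produce
a certificate. -/
theorem mem_dict_of_real {p n : Type*} [Fintype n] {Φ Ψ : Matrix (Fin 2) (Fin 2) ℂ}
    {F G : Matrix p n ℂ} {t : ℝ} {a : n → ℂ} (ha : F *ᵥ a = (t : ℂ) • G *ᵥ a)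
    (hΦ : quadForm Φ t 1 = 0) (hΨ : (quadForm Ψ t 1).re ≤ 0) : a ∈ dict Φ Ψ F G := by
  refine ⟨((t : ℂ), 1), ⟨by simp, hΦ, hΨ⟩, ?_⟩
  simp only [sub_mulVec, smul_mulVec, one_smul, ha, sub_self]

theorem isHermitian_real_smul {p : Type*} {P : Matrix p p ℂ} (hP : P.IsHermitian) (r : ℝ) :
    ((r : ℂ) • P).IsHermitian := by
  rw [IsHermitian, conjTranspose_smul, hP.eq, Complex.star_def, Complex.conj_ofReal]

/-- At `(t, 1)` with `t` real, `q_Φ` vanishes and `q_Ψ = -2 k t`, so the relevant points are `t ≥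
0`. The factors `δ` and `k` are absorbed in `P` and `Q`; only `k` needs a sign. -/
theorem kypProperty_halfLine {δ k : ℝ} (hδ : δ ≠ 0) (hk : 0 < k) :
    KYPProperty.{u, v} !![0, δ * Complex.I; -(δ * Complex.I), 0] !![0, -(k : ℂ); -(k : ℂ), 0] := by
  intro p n _ _ F G hreg M hM hpos
  obtain ⟨⟨T, P, Q⟩, ⟨hT, hP, hQ, -⟩, rfl⟩ := exists_certificate True hreg hM fun t ht a ha =>
    hpos a (mem_dict_of_real ha (by simp [quadForm_eq]; ring) (by
      simp [quadForm_eq]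
      nlinarith [mul_nonneg hk.le (ht trivial)]))
  refine ⟨((δ⁻¹ : ℝ) : ℂ) • P, ((k⁻¹ : ℝ) : ℂ) • Q, isHermitian_real_smul hP _,
    hQ.smul (by exact_mod_cast (inv_pos.2 hk).le), ?_⟩
  have hδ' : (δ : ℂ) ≠ 0 := by exact_mod_cast hδ
  have hk' : (k : ℂ) ≠ 0 := by exact_mod_cast hk.ne'
  convert hT using 1
  simp only [certificateMap, LinearMap.coe_mk, AddHom.coe_mk, pencilForm, Matrix.mul_smul,
    Matrix.smul_mul, of_apply, cons_val_zero, cons_val_one, cons_val', cons_val_fin_one, smul_smul,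
    Complex.ofReal_inv, zero_smul, add_zero, zero_add, zero_mul, neg_mul, mul_inv_cancel₀ hk',
    mul_right_comm _ Complex.I, mul_inv_cancel₀ hδ', one_mul]
  module

/-- `q_Ψ ≤ 0` holds on the whole real line, so `Ψ` imposes nothing there and `Q = 0` serves. -/
theorem kypProperty_line {δ α β γ : ℝ} (hδ : δ ≠ 0)
    (hneg : ∀ t : ℝ, α * t ^ 2 + 2 * β * t + γ ≤ 0) :
    KYPProperty.{u, v} !![0, δ * Complex.I; -(δ * Complex.I), 0] !![(α : ℂ), β; β, γ] := by
  intro p n _ _ F G hreg M hM hpos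
  obtain ⟨⟨T, P, Q⟩, ⟨hT, hP, -, hQ⟩, rfl⟩ := exists_certificate False hreg hM fun t _ a ha =>
    hpos a (mem_dict_of_real ha (by simp [quadForm_eq]; ring) (by
      simp [quadForm_eq]
      linarith [hneg t]))
  refine ⟨((δ⁻¹ : ℝ) : ℂ) • P, 0, isHermitian_real_smul hP _, .zero, ?_⟩
  have hδ' : (δ : ℂ) ≠ 0 := by exact_mod_cast hδ
  obtain rfl : Q = 0 := hQ id
  rw [pencilForm_zero]
  convert hT using 1
  simp only [certificateMap, LinearMap.coe_mk, AddHom.coe_mk, pencilForm, Matrix.mul_smul,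
    Matrix.smul_mul, of_apply, cons_val_zero, cons_val_one, cons_val', cons_val_fin_one, smul_smul,
    Complex.ofReal_inv, add_zero, neg_mul, Matrix.mul_zero, Matrix.zero_mul,
    mul_right_comm _ Complex.I, mul_inv_cancel₀ hδ', one_mul]
  module

theorem quadForm_congr (S Θ : Matrix (Fin 2) (Fin 2) ℂ) (μ ν : ℂ) :
    quadForm (Sᴴ * Θ * S) μ ν = quadForm Θ (S 0 0 * μ + S 0 1 * ν) (S 1 0 * μ + S 1 1 * ν) := by
  simp only [quadForm_eq, mul_apply, Fin.sum_univ_two, conjTranspose_apply, star_add, star_mul']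
  ring

theorem pencilForm_congr {p n : Type*} [Fintype p] (S Θ : Matrix (Fin 2) (Fin 2) ℂ)
    (F G : Matrix p n ℂ) (P : Matrix p p ℂ) :
    pencilForm Θ (S 0 0 • F + S 0 1 • G) (S 1 0 • F + S 1 1 • G) P
      = pencilForm (Sᴴ * Θ * S) F G P := by
  simp only [pencilForm, mul_apply, Fin.sum_univ_two, conjTranspose_apply, conjTranspose_add,
    conjTranspose_smul, Matrix.add_mul, Matrix.mul_add, Matrix.smul_mul, Matrix.mul_smul]
  module

theorem pencil_congr {p n : Type*} (S : Matrix (Fin 2) (Fin 2) ℂ) (F G : Matrix p n ℂ) (μ ν : ℂ) :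
    (S 0 0 * μ + S 0 1 * ν) • (S 1 0 • F + S 1 1 • G)
      - (S 1 0 * μ + S 1 1 * ν) • (S 0 0 • F + S 0 1 • G) = S.det • (μ • G - ν • F) := by
  rw [det_fin_two]
  module

theorem congr_pair_ne_zero {S : Matrix (Fin 2) (Fin 2) ℂ} (hS : S.det ≠ 0) {μ ν : ℂ}
    (h : (μ, ν) ≠ 0) : (S 0 0 * μ + S 0 1 * ν, S 1 0 * μ + S 1 1 * ν) ≠ 0 := by
  contrapose! h
  rw [Prod.mk_eq_zero] at h ⊢
  rw [det_fin_two] at hS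
  exact ⟨(mul_eq_zero.1 (by linear_combination S 1 1 * h.1 - S 0 1 * h.2 :
      (S 0 0 * S 1 1 - S 0 1 * S 1 0) * μ = 0)).resolve_left hS,
    (mul_eq_zero.1 (by linear_combination S 0 0 * h.2 - S 1 0 * h.1 :
      (S 0 0 * S 1 1 - S 0 1 * S 1 0) * ν = 0)).resolve_left hS⟩

theorem exists_pencil_congr {p n : Type*} {S : Matrix (Fin 2) (Fin 2) ℂ} (hS : S.det ≠ 0)
    (F G : Matrix p n ℂ) : ∃ F' G' : Matrix p n ℂ,
      F = S 0 0 • F' + S 0 1 • G' ∧ G = S 1 0 • F' + S 1 1 • G' := by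
  refine ⟨S.det⁻¹ • (S 1 1 • F - S 0 1 • G), S.det⁻¹ • (S 0 0 • G - S 1 0 • F), ?_, ?_⟩
  · have : S.det⁻¹ • (S.det • F) = F := inv_smul_smul₀ hS F
    conv_lhs => rw [← this]
    rw [det_fin_two]
    module
  · have : S.det⁻¹ • (S.det • G) = G := inv_smul_smul₀ hS G
    conv_lhs => rw [← this]
    rw [det_fin_two]
    module

/-- A linear change of `(μ, ν)` acts on the curve as a Möbius transformation. The pair `(F, G)` is
changed along with it, and the same `P` and `Q` serve. -/
theorem KYPProperty.of_congr {Φ Ψ S : Matrix (Fin 2) (Fin 2) ℂ} (hS : S.det ≠ 0)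
    (h : KYPProperty.{u, v} (Sᴴ * Φ * S) (Sᴴ * Ψ * S)) : KYPProperty.{u, v} Φ Ψ := by
  intro p n _ _ F G hreg M hM hpos
  obtain ⟨F, G, rfl, rfl⟩ := exists_pencil_congr hS F G
  have hreg' : LeftRegular F G := by
    intro μ ν hc z hz
    refine hreg _ _ (congr_pair_ne_zero hS hc) z ?_
    rw [pencil_congr, vecMul_smul, hz, smul_zero]
  obtain ⟨P, Q, hP, hQ, hPQ⟩ := h p n F G hreg' M hM fun a ⟨c, ⟨hc0, hc1, hc2⟩, hca⟩ => hpos a (by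
    rw [quadForm_congr] at hc1 hc2
    refine ⟨(S 0 0 * c.1 + S 0 1 * c.2, S 1 0 * c.1 + S 1 1 * c.2),
      ⟨congr_pair_ne_zero hS hc0, hc1, hc2⟩, ?_⟩
    rw [pencil_congr, smul_mulVec, hca, smul_zero])
  exact ⟨P, Q, hP, hQ, by rwa [pencilForm_congr, pencilForm_congr]⟩

/-- On the curve `q_Φ = 0`, so multiples of `Φ` in `Ψ` do not matter; in the certificate they move
into `P`. -/
theorem KYPProperty.of_sub_smul {Φ Ψ : Matrix (Fin 2) (Fin 2) ℂ} (κ : ℝ)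
    (h : KYPProperty.{u, v} Φ (Ψ - (κ : ℂ) • Φ)) : KYPProperty.{u, v} Φ Ψ := by
  intro p n _ _ F G hreg M hM hpos
  have hq : ∀ μ ν, quadForm (Ψ - (κ : ℂ) • Φ) μ ν = quadForm Ψ μ ν - κ * quadForm Φ μ ν := by
    intro μ ν
    simp only [quadForm_eq, Matrix.sub_apply, Matrix.smul_apply, smul_eq_mul]
    ring
  obtain ⟨P, Q, hP, hQ, hPQ⟩ := h p n F G hreg M hM fun a ⟨c, ⟨hc0, hc1, hc2⟩, hca⟩ => hpos a
    ⟨c, ⟨hc0, hc1, by rwa [hq, hc1, mul_zero, sub_zero] at hc2⟩, hca⟩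
  refine ⟨P - (κ : ℂ) • Q, Q, hP.sub (isHermitian_real_smul hQ.isHermitian κ), hQ, ?_⟩
  convert hPQ using 1
  simp only [pencilForm, Matrix.sub_apply, Matrix.smul_apply, Matrix.mul_sub, Matrix.sub_mul,
    Matrix.mul_smul, Matrix.smul_mul, smul_eq_mul]
  module

/-- The signs of `α` and `γ` say that infinity and zero are on the curve. Depending on the
discriminant of `α t² + 2 β t + γ`, the curve is the whole line or an arc between two roots, one of
them infinite if `α = 0`; an arc is carried to the half-line. -/
theorem kypProperty_of_real {α β γ : ℝ} (hα : α ≤ 0) (hγ : γ ≤ 0) :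
    KYPProperty.{u, v} !![0, Complex.I; -Complex.I, 0] !![(α : ℂ), β; β, γ] := by
  rcases le_or_gt (β ^ 2) (α * γ) with hle | hlt
  · have := kypProperty_line (δ := 1) (α := α) (β := β) (γ := γ) one_ne_zero fun t => by
      rcases hα.lt_or_eq with hα' | rfl
      · have h1 : 0 ≤ α * (α * t ^ 2 + 2 * β * t + γ) := by nlinarith [sq_nonneg (α * t + β)]
        exact nonpos_of_mul_nonneg_right h1 hα'
      · have : β = 0 := by nlinarith
        simp [this, hγ]
    simpa using this
  · have hs : 0 < β ^ 2 - α * γ := by linarith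
    rcases hα.lt_or_eq with hα' | rfl
    · obtain ⟨s, hs0, hs2⟩ : ∃ s : ℝ, 0 < s ∧ s ^ 2 = β ^ 2 - α * γ :=
        ⟨√(β ^ 2 - α * γ), Real.sqrt_pos.2 hs, Real.sq_sqrt hs.le⟩
      have hs2' : (s : ℂ) ^ 2 = β ^ 2 - α * γ := by exact_mod_cast hs2
      have hdet : -2 * α * s ≠ 0 := by
        have := mul_pos (neg_pos.2 hα') hs0
        nlinarith
      have hk : 0 < -2 * α * s ^ 2 := by
        have := mul_pos (neg_pos.2 hα') (pow_pos hs0 2)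
        nlinarith
      -- The columns are the roots `(-β ± s) / α` in homogeneous coordinates, which become the end
      -- points infinity and zero.
      refine KYPProperty.of_congr (S := !![(-β + s : ℂ), β + s; α, -α]) ?_ ?_
      · rw [det_fin_two_of]
        have : ((-2 * α * s : ℝ) : ℂ) ≠ 0 := by exact_mod_cast hdet
        push_cast at this
        convert this using 1
        ring
      · convert kypProperty_halfLine hdet hk using 1
        · ext i j
          fin_cases i <;> fin_cases j <;> simp [mul_apply, Fin.sum_univ_two] <;> ring
        · ext i j
          fin_cases i <;> fin_cases j <;> simp [mul_apply, Fin.sum_univ_two]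
          · linear_combination (α : ℂ) * hs2'
          · linear_combination -(α : ℂ) * hs2'
          · linear_combination -(α : ℂ) * hs2'
          · linear_combination (α : ℂ) * hs2'
    · have hβ : β ≠ 0 := by
        rintro rfl
        simp at hs
      obtain ⟨r, hr⟩ : ∃ r : ℝ, r = -2 * β := ⟨_, rfl⟩
      have hr0 : r ≠ 0 := by simpa [hr] using hβ
      have hr' : (r : ℂ) = -2 * β := by exact_mod_cast hr
      have hk : 0 < -β * r := by
        rw [hr]
        nlinarith
      -- The columns represent infinity and the finite root `-γ / (2 β)`.
      refine KYPProperty.of_congr (S := !![(1 : ℂ), γ; 0, r]) ?_ ?_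
      · rw [det_fin_two_of]
        have : (r : ℂ) ≠ 0 := by exact_mod_cast hr0
        simpa using this
      · convert kypProperty_halfLine hr0 hk using 1
        · ext i j
          fin_cases i <;> fin_cases j <;> simp [mul_apply, Fin.sum_univ_two] <;> ring
        · ext i j
          fin_cases i <;> fin_cases j <;> simp [mul_apply, Fin.sum_univ_two]
          · ring
          · linear_combination (γ : ℂ) * r * hr'

/-- The generalized Kalman-Yakubovich-Popov lemma. -/
theorem kypProperty_of_curveNontrivial {Φ Ψ : Matrix (Fin 2) (Fin 2) ℂ} (hΦ : Φ.IsHermitian)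
    (hΨ : Ψ.IsHermitian) (hdet : Φ.det.re < 0) (hcurve : CurveNontrivial Φ Ψ) :
    KYPProperty Φ Ψ := by
  obtain ⟨⟨c₁, c₂⟩, ⟨-, hc1, hc2⟩, ⟨d₁, d₂⟩, ⟨-, hd1, hd2⟩, hcd⟩ := hcurve
  simp only at hc1 hc2 hd1 hd2 hcd
  -- With the two given curve points as columns, the second scaled by `w`, the congruence has values
  -- of `q_Θ` at curve points on its diagonal, up to `|w|²`.
  have hcongr : ∀ {Θ : Matrix (Fin 2) (Fin 2) ℂ}, Θ.IsHermitian → ∀ w : ℂ,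
      !![c₁, d₁ * w; c₂, d₂ * w]ᴴ * Θ * !![c₁, d₁ * w; c₂, d₂ * w] =
      !![quadForm Θ c₁ c₂, (star c₁ * (Θ 0 0 * d₁ + Θ 0 1 * d₂)
          + star c₂ * (Θ 1 0 * d₁ + Θ 1 1 * d₂)) * w;
        star ((star c₁ * (Θ 0 0 * d₁ + Θ 0 1 * d₂)
          + star c₂ * (Θ 1 0 * d₁ + Θ 1 1 * d₂)) * w), star w * w * quadForm Θ d₁ d₂] := by
    intro Θ hΘ w
    have h00 : star (Θ 0 0) = Θ 0 0 := hΘ.apply 0 0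
    have h01 : star (Θ 0 1) = Θ 1 0 := hΘ.apply 1 0
    have h10 : star (Θ 1 0) = Θ 0 1 := hΘ.apply 0 1
    have h11 : star (Θ 1 1) = Θ 1 1 := hΘ.apply 1 1
    ext i j
    fin_cases i <;> fin_cases j <;>
      simp only [mul_apply, Fin.sum_univ_two, conjTranspose_apply, quadForm_eq, star_mul',
        star_add, star_star, h00, h01, h10, h11, of_apply, cons_val', cons_val_zero, cons_val_one,
        cons_val_fin_one, Fin.zero_eta, Fin.mk_one, Fin.isValue] <;> ring
  set φ := star c₁ * (Φ 0 0 * d₁ + Φ 0 1 * d₂) + star c₂ * (Φ 1 0 * d₁ + Φ 1 1 * d₂) with hφdef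
  -- Otherwise the congruent matrix would be singular, although `Φ` and the matrix with columns `c`,
  -- `d` are not.
  have hφ : φ ≠ 0 := by
    intro h0
    have h1 := congrArg Matrix.det (hcongr hΦ 1)
    rw [← hφdef, h0, hc1, det_mul, det_mul, det_conjTranspose, det_fin_two_of, det_fin_two_of] at h1
    simp only [zero_mul, mul_zero, star_zero, sub_zero, mul_one, mul_eq_zero, star_eq_zero] at h1
    have h2 : c₁ * d₂ - d₁ * c₂ ≠ 0 := sub_ne_zero.2 hcd
    have h3 : Φ.det ≠ 0 := fun h => by simp [h] at hdet
    tauto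
  -- This scaling makes the off-diagonal entry of the transformed `Φ` equal to `i`.
  set w := Complex.I / φ with hw
  have hw0 : w ≠ 0 := div_ne_zero Complex.I_ne_zero hφ
  refine KYPProperty.of_congr (S := !![c₁, d₁ * w; c₂, d₂ * w]) ?_ ?_
  · rw [det_fin_two_of]
    have : c₁ * (d₂ * w) - d₁ * w * c₂ = (c₁ * d₂ - d₁ * c₂) * w := by ring
    rw [this]
    exact mul_ne_zero (sub_ne_zero.2 hcd) hw0
  rw [hcongr hΦ, hcongr hΨ]
  set ψ := (star c₁ * (Ψ 0 0 * d₁ + Ψ 0 1 * d₂) + star c₂ * (Ψ 1 0 * d₁ + Ψ 1 1 * d₂)) * w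
  have hreal : ∀ μ ν, ((quadForm Ψ μ ν).re : ℂ) = quadForm Ψ μ ν := fun μ ν =>
    Complex.ext rfl (hΨ.im_star_dotProduct_mulVec_self ![μ, ν]).symm
  -- Subtracting this multiple of the transformed `Φ` makes `Ψ` real.
  refine KYPProperty.of_sub_smul ψ.im ?_
  have hnorm : star w * w = (Complex.normSq w : ℂ) := by
    rw [Complex.star_def, mul_comm, Complex.mul_conj]
  convert kypProperty_of_real (α := (quadForm Ψ c₁ c₂).re) (β := ψ.re)
    (γ := Complex.normSq w * (quadForm Ψ d₁ d₂).re) hc2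
    (mul_nonpos_of_nonneg_of_nonpos (Complex.normSq_nonneg w) hd2) using 1
  · rw [← hφdef, hc1, hd1, hw, mul_div_cancel₀ _ hφ]
    simp
  · rw [← hφdef, hc1, hd1, hw, mul_div_cancel₀ _ hφ, ← hw, hnorm]
    ext i j
    fin_cases i <;> fin_cases j <;> simp [hreal]
    · exact Complex.ext (by simp) (by simp)
    · exact Complex.ext (by simp) (by simp)

end

/-! ### Euclidean and spectral norms -/

section Norm

variable {ι : Type*} [Fintype ι]

theorem euclNorm_nonneg (x : ι → ℂ) : 0 ≤ euclNorm x := norm_nonneg _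

theorem euclNorm_smul (c : ℂ) (x : ι → ℂ) : euclNorm (c • x) = ‖c‖ * euclNorm x := by
  rw [euclNorm, WithLp.toLp_smul, norm_smul, euclNorm]

theorem re_star_dotProduct_le (x y : ι → ℂ) : (star x ⬝ᵥ y).re ≤ euclNorm x * euclNorm y := by
  have := re_inner_le_norm (𝕜 := ℂ) (WithLp.toLp 2 x : EuclideanSpace ℂ ι) (WithLp.toLp 2 y)
  rw [EuclideanSpace.inner_eq_star_dotProduct, dotProduct_comm] at this
  exact this

theorem star_dotProduct_self_eq (x : ι → ℂ) : star x ⬝ᵥ x = ((euclNorm x ^ 2 : ℝ) : ℂ) := by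
  have := inner_self_eq_norm_sq_to_K (𝕜 := ℂ) (WithLp.toLp 2 x : EuclideanSpace ℂ ι)
  rw [EuclideanSpace.inner_eq_star_dotProduct, dotProduct_comm] at this
  rw [euclNorm, Complex.ofReal_pow]
  exact this

theorem star_dotProduct_gram_mulVec {m : Type*} [Fintype m] (E : Matrix m ι ℂ) (x : ι → ℂ) :
    star x ⬝ᵥ (Eᴴ * E) *ᵥ x = ((euclNorm (E *ᵥ x) ^ 2 : ℝ) : ℂ) := by
  rw [← mulVec_mulVec, dotProduct_mulVec, ← star_mulVec, star_dotProduct_self_eq]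

theorem specNorm_le_one_iff {l m : Type*} [Fintype l] [Fintype m] [DecidableEq m]
    (M : Matrix l m ℂ) : specNorm M ≤ 1 ↔ ∀ u, euclNorm (M *ᵥ u) ≤ euclNorm u := by
  classical
  rw [specNorm, Matrix.l2_opNorm_def, ContinuousLinearMap.opNorm_le_iff zero_le_one]
  simp only [one_mul]
  exact ⟨fun h u => h (WithLp.toLp 2 u), fun h u => h u.ofLp⟩

end Norm

/-! ### Block-diagonal pencils: the bounds, the matrix inequality and the conjugate -/

section Blocks

variable {p₁ p₂ n₁ n₂ m₁ m₂ : Type*} [Fintype n₁] [Fintype n₂] [Fintype m₁] [Fintype m₂]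

/-- The bound `Re(vᴴ Z w) ≤ (‖E₁ v‖² + ‖E₂ w‖²) / 2` on `𝒜`. -/
def SumBound (Φ Ψ : Matrix (Fin 2) (Fin 2) ℂ) (F₁ G₁ : Matrix p₁ n₁ ℂ)
    (F₂ G₂ : Matrix p₂ n₂ ℂ) (E₁ : Matrix m₁ n₁ ℂ) (E₂ : Matrix m₂ n₂ ℂ)
    (Z : Matrix n₁ n₂ ℂ) : Prop :=
  ∀ (v : n₁ → ℂ) (w : n₂ → ℂ),
    Sum.elim v w ∈ dict Φ Ψ (diagBlocks F₁ F₂) (diagBlocks G₁ G₂) →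
    (star v ⬝ᵥ (Z *ᵥ w)).re ≤ (euclNorm (E₁ *ᵥ v) ^ 2 + euclNorm (E₂ *ᵥ w) ^ 2) / 2

/-- The bound `Re(vᴴ Z w) ≤ ‖E₁ v‖ ‖E₂ w‖` on `𝒜`. -/
def ProdBound (Φ Ψ : Matrix (Fin 2) (Fin 2) ℂ) (F₁ G₁ : Matrix p₁ n₁ ℂ)
    (F₂ G₂ : Matrix p₂ n₂ ℂ) (E₁ : Matrix m₁ n₁ ℂ) (E₂ : Matrix m₂ n₂ ℂ)
    (Z : Matrix n₁ n₂ ℂ) : Prop :=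
  ∀ (v : n₁ → ℂ) (w : n₂ → ℂ),
    Sum.elim v w ∈ dict Φ Ψ (diagBlocks F₁ F₂) (diagBlocks G₁ G₂) →
    (star v ⬝ᵥ (Z *ᵥ w)).re ≤ euclNorm (E₁ *ᵥ v) * euclNorm (E₂ *ᵥ w)

variable {Φ Ψ : Matrix (Fin 2) (Fin 2) ℂ} {F₁ G₁ : Matrix p₁ n₁ ℂ} {F₂ G₂ : Matrix p₂ n₂ ℂ}
  {E₁ : Matrix m₁ n₁ ℂ} {E₂ : Matrix m₂ n₂ ℂ} {Z : Matrix n₁ n₂ ℂ}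

theorem diagBlocks_mulVec (M₁ : Matrix p₁ n₁ ℂ) (M₂ : Matrix p₂ n₂ ℂ) (v : n₁ → ℂ) (w : n₂ → ℂ) :
    diagBlocks M₁ M₂ *ᵥ Sum.elim v w = Sum.elim (M₁ *ᵥ v) (M₂ *ᵥ w) := by
  rw [diagBlocks, fromBlocks_mulVec]
  simp

theorem pencil_diagBlocks {n₁ n₂ : Type*} (F₁ G₁ : Matrix p₁ n₁ ℂ) (F₂ G₂ : Matrix p₂ n₂ ℂ) (μ ν : ℂ) :
    μ • diagBlocks G₁ G₂ - ν • diagBlocks F₁ F₂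
      = diagBlocks (μ • G₁ - ν • F₁) (μ • G₂ - ν • F₂) := by
  ext (i | i) (j | j) <;> simp [diagBlocks]

theorem mem_dict_diagBlocks {v : n₁ → ℂ} {w : n₂ → ℂ} :
    Sum.elim v w ∈ dict Φ Ψ (diagBlocks F₁ F₂) (diagBlocks G₁ G₂) ↔
      ∃ c ∈ curve Φ Ψ, (c.1 • G₁ - c.2 • F₁) *ᵥ v = 0 ∧ (c.1 • G₂ - c.2 • F₂) *ᵥ w = 0 := by
  have h0 : ∀ (x : p₁ → ℂ) (y : p₂ → ℂ), Sum.elim x y = 0 ↔ x = 0 ∧ y = 0 := fun x y => by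
    constructor
    · intro h
      exact ⟨funext fun i => congrFun h (Sum.inl i), funext fun i => congrFun h (Sum.inr i)⟩
    · rintro ⟨rfl, rfl⟩
      exact Sum.elim_zero_zero
  simp only [dict, Set.mem_ofPred_eq, pencil_diagBlocks, diagBlocks_mulVec, h0]

theorem smul_mem_dict_diagBlocks {v : n₁ → ℂ} {w : n₂ → ℂ}
    (h : Sum.elim v w ∈ dict Φ Ψ (diagBlocks F₁ F₂) (diagBlocks G₁ G₂)) (s t : ℂ) :
    Sum.elim (s • v) (t • w) ∈ dict Φ Ψ (diagBlocks F₁ F₂) (diagBlocks G₁ G₂) := by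
  rw [mem_dict_diagBlocks] at h ⊢
  obtain ⟨c, hc, h1, h2⟩ := h
  exact ⟨c, hc, by rw [mulVec_smul, h1, smul_zero], by rw [mulVec_smul, h2, smul_zero]⟩

/-- The choice `t² = b / a` equalizes the two squares; adding `ε` to both numbers covers the case
that one is zero. -/
theorem le_mul_of_forall_le_scaled {x a b : ℝ} (ha : 0 ≤ a) (hb : 0 ≤ b)
    (h : ∀ t : ℝ, 0 < t → x ≤ ((t * a) ^ 2 + (t⁻¹ * b) ^ 2) / 2) : x ≤ a * b := by
  have key : ∀ ε : ℝ, 0 < ε → x ≤ (a + ε) * (b + ε) := by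
    intro ε hε
    have ha' : 0 < a + ε := by linarith
    have hb' : 0 < b + ε := by linarith
    have hs : 0 < (b + ε) / (a + ε) := div_pos hb' ha'
    have h1 := h (√((b + ε) / (a + ε))) (Real.sqrt_pos.2 hs)
    rw [mul_pow, mul_pow, inv_pow, Real.sq_sqrt hs.le] at h1
    have h2 : (b + ε) / (a + ε) * a ^ 2 ≤ (b + ε) / (a + ε) * (a + ε) ^ 2 := by gcongr; linarith
    have h3 : ((b + ε) / (a + ε))⁻¹ * b ^ 2 ≤ ((b + ε) / (a + ε))⁻¹ * (b + ε) ^ 2 := by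
      gcongr; linarith
    have h4 : (b + ε) / (a + ε) * (a + ε) ^ 2 = (a + ε) * (b + ε) := by field_simp
    have h5 : ((b + ε) / (a + ε))⁻¹ * (b + ε) ^ 2 = (a + ε) * (b + ε) := by field_simp
    linarith
  have hlim : Filter.Tendsto (fun ε : ℝ => (a + ε) * (b + ε)) (nhdsWithin 0 (Set.Ioi 0))
      (nhds ((a + 0) * (b + 0))) :=
    tendsto_nhdsWithin_of_tendsto_nhds (Continuous.tendsto (by fun_prop) 0)
  have := ge_of_tendsto hlim (Filter.eventually_of_mem self_mem_nhdsWithin fun ε hε => key ε hε)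
  simpa using this

/-- Replacing `(v, w)` by `(t v, t⁻¹ w)` stays in `𝒜` and keeps `vᴴ Z w`. The converse is the
inequality of the means. -/
theorem sumBound_iff_prodBound :
    SumBound Φ Ψ F₁ G₁ F₂ G₂ E₁ E₂ Z ↔ ProdBound Φ Ψ F₁ G₁ F₂ G₂ E₁ E₂ Z := by
  constructor
  · intro h v w hvw
    refine le_mul_of_forall_le_scaled (euclNorm_nonneg _) (euclNorm_nonneg _) fun t ht => ?_
    have h1 := h _ _ (smul_mem_dict_diagBlocks hvw t (t : ℂ)⁻¹)
    have ht' : (t : ℂ) ≠ 0 := by exact_mod_cast ht.ne'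
    have hn : ‖(t : ℂ)‖ = t := by rw [Complex.norm_real, Real.norm_of_nonneg ht.le]
    rwa [mulVec_smul, mulVec_smul, mulVec_smul, euclNorm_smul, euclNorm_smul, norm_inv, hn,
      star_smul, smul_dotProduct, dotProduct_smul, Complex.star_def, Complex.conj_ofReal,
      smul_inv_smul₀ ht'] at h1
  · intro h v w hvw
    have := h v w hvw
    nlinarith [sq_nonneg (euclNorm (E₁ *ᵥ v) - euclNorm (E₂ *ᵥ w))]

theorem re_star_dotProduct_gap_mulVec (E₁ : Matrix m₁ n₁ ℂ) (E₂ : Matrix m₂ n₂ ℂ)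
    (Z : Matrix n₁ n₂ ℂ) (v : n₁ → ℂ) (w : n₂ → ℂ) :
    (star (Sum.elim v w) ⬝ᵥ (diagBlocks (E₁ᴴ * E₁) (E₂ᴴ * E₂) - fromBlocks 0 Z Zᴴ 0)
      *ᵥ Sum.elim v w).re = euclNorm (E₁ *ᵥ v) ^ 2 + euclNorm (E₂ *ᵥ w) ^ 2
        - 2 * (star v ⬝ᵥ (Z *ᵥ w)).re := by
  have hstar : star (Sum.elim v w) = Sum.elim (star v) (star w) := by
    ext (i | i) <;> rfl
  have hZ : star w ⬝ᵥ (Zᴴ *ᵥ v) = star (star v ⬝ᵥ (Z *ᵥ w)) := by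
    rw [dotProduct_mulVec, ← star_mulVec, star_dotProduct]
  rw [sub_mulVec, diagBlocks_mulVec, fromBlocks_mulVec, hstar, dotProduct_sub]
  simp only [Sum.elim_comp_inl, Sum.elim_comp_inr, zero_mulVec, zero_add, add_zero,
    sumElim_dotProduct_sumElim]
  rw [hZ, star_dotProduct_gram_mulVec, star_dotProduct_gram_mulVec, ← Complex.ofReal_add,
    Complex.sub_re, Complex.ofReal_re, Complex.add_re, Complex.star_def, Complex.conj_re]
  ring

/-- A common vector `y` lets every form `[F; G]ᴴ (Θ ⊗ P) [F; G]` factor at `a` as `q_Θ(μ, ν)` times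
`yᴴ P y`. -/
theorem exists_eq_smul_of_pencil_mulVec_eq_zero {p n : Type*} [Fintype n] {F G : Matrix p n ℂ}
    {a : n → ℂ} {c : ℂ × ℂ} (hc : c ≠ 0) (h : (c.1 • G - c.2 • F) *ᵥ a = 0) :
    ∃ y, F *ᵥ a = c.1 • y ∧ G *ᵥ a = c.2 • y := by
  rw [sub_mulVec, smul_mulVec, smul_mulVec, sub_eq_zero] at h
  by_cases h1 : c.1 = 0
  · have h2 : c.2 ≠ 0 := fun h2 => hc (Prod.ext h1 h2)
    refine ⟨c.2⁻¹ • G *ᵥ a, ?_, (smul_inv_smul₀ h2 _).symm⟩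
    rw [h1, zero_smul] at h
    rw [h1, zero_smul]
    exact (smul_eq_zero.1 h.symm).resolve_left h2
  · refine ⟨c.1⁻¹ • F *ᵥ a, (smul_inv_smul₀ h1 _).symm, ?_⟩
    rw [smul_comm, ← h, inv_smul_smul₀ h1]

theorem lmiFeasible_iff {p₁ p₂ n₁ n₂ : Type*} [Fintype p₁] [Fintype p₂] {F₁ G₁ : Matrix p₁ n₁ ℂ}
    {F₂ G₂ : Matrix p₂ n₂ ℂ} {E₁ : Matrix m₁ n₁ ℂ} {E₂ : Matrix m₂ n₂ ℂ} {Z : Matrix n₁ n₂ ℂ} :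
    LMIFeasible Φ Ψ F₁ G₁ F₂ G₂ E₁ E₂ Z ↔
    ∃ P Q : Matrix (p₁ ⊕ p₂) (p₁ ⊕ p₂) ℂ, P.IsHermitian ∧ Q.PosSemidef ∧
      (diagBlocks (E₁ᴴ * E₁) (E₂ᴴ * E₂) - fromBlocks 0 Z Zᴴ 0
        + pencilForm Φ (diagBlocks F₁ F₂) (diagBlocks G₁ G₂) P
        + pencilForm Ψ (diagBlocks F₁ F₂) (diagBlocks G₁ G₂) Q).PosSemidef := by
  simp only [LMIFeasible, Matrix.mul_add, Matrix.add_mul, stack_conjTranspose_mul_kronecker_mul,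
    sub_sub_eq_add_sub, ← sub_add_eq_add_sub, ← add_assoc]

/-- At a vector of `𝒜` the `P` term vanishes with `q_Φ`, and the `Q` term is `q_Ψ ≤ 0` times `yᴴ Q y
≥ 0`. No rank condition enters. -/
theorem LMIFeasible.sumBound [Fintype p₁] [Fintype p₂] (hΨ : Ψ.IsHermitian) (h : LMIFeasible Φ Ψ F₁ G₁ F₂ G₂ E₁ E₂ Z) :
    SumBound Φ Ψ F₁ G₁ F₂ G₂ E₁ E₂ Z := by
  obtain ⟨P, Q, -, hQ, hPQ⟩ := lmiFeasible_iff.1 h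
  intro v w ⟨c, ⟨hc0, hc1, hc2⟩, hcvw⟩
  obtain ⟨y, hF, hG⟩ := exists_eq_smul_of_pencil_mulVec_eq_zero hc0 hcvw
  have h1 := hPQ.re_dotProduct_nonneg (Sum.elim v w)
  rw [add_mulVec, add_mulVec, dotProduct_add, dotProduct_add,
    star_dotProduct_pencilForm_mulVec Φ P hF hG, star_dotProduct_pencilForm_mulVec Ψ Q hF hG, hc1,
    zero_mul, add_zero, map_add] at h1
  have h2 := re_star_dotProduct_gap_mulVec E₁ E₂ Z v w
  have h3 : (quadForm Ψ c.1 c.2).im = 0 := hΨ.im_star_dotProduct_mulVec_self ![c.1, c.2]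
  have h4 := hQ.re_dotProduct_nonneg y
  have h5 : (quadForm Ψ c.1 c.2 * (star y ⬝ᵥ Q *ᵥ y)).re
      = (quadForm Ψ c.1 c.2).re * (star y ⬝ᵥ Q *ᵥ y).re := by
    rw [Complex.mul_re, h3, zero_mul, sub_zero]
  have h6 := mul_nonpos_of_nonpos_of_nonneg hc2 h4
  change 0 ≤ Complex.re _ + Complex.re _ at h1
  rw [h2, h5] at h1
  change _ * Complex.re _ ≤ 0 at h6
  linarith

theorem lmiFeasible_iff_sumBound [Fintype p₁] [Fintype p₂] (hΦ : Φ.IsHermitian) (hΨ : Ψ.IsHermitian) (hdet : Φ.det.re < 0)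
    (hcurve : CurveNontrivial Φ Ψ)
    (hrank : FullRowRank (diagBlocks F₁ F₂) (diagBlocks G₁ G₂)) :
    LMIFeasible Φ Ψ F₁ G₁ F₂ G₂ E₁ E₂ Z ↔ SumBound Φ Ψ F₁ G₁ F₂ G₂ E₁ E₂ Z := by
  refine ⟨LMIFeasible.sumBound hΨ, fun h => lmiFeasible_iff.2 ?_⟩
  refine kypProperty_of_curveNontrivial hΦ hΨ hdet hcurve _ _ _ _ hrank.leftRegular _ ?_ ?_
  · refine IsHermitian.sub (IsHermitian.fromBlocks ?_ (by simp) ?_)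
      (IsHermitian.fromBlocks isHermitian_zero rfl isHermitian_zero)
    · exact isHermitian_conjTranspose_mul_self E₁
    · exact isHermitian_conjTranspose_mul_self E₂
  · intro a ha
    obtain ⟨v, w, rfl⟩ : ∃ v w, a = Sum.elim v w :=
      ⟨a ∘ Sum.inl, a ∘ Sum.inr, (Sum.elim_comp_inl_inr a).symm⟩
    rw [re_star_dotProduct_gap_mulVec]
    linarith [h v w ha]

theorem euclNorm_sq_sumElim {ι κ : Type*} [Fintype ι] [Fintype κ] (x : ι → ℂ) (y : κ → ℂ) :
    euclNorm (Sum.elim x y) ^ 2 = euclNorm x ^ 2 + euclNorm y ^ 2 := by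
  have hstar : star (Sum.elim x y) = Sum.elim (star x) (star y) := by
    ext (i | i) <;> rfl
  have h := star_dotProduct_self_eq (Sum.elim x y)
  rw [hstar, sumElim_dotProduct_sumElim, star_dotProduct_self_eq, star_dotProduct_self_eq] at h
  exact_mod_cast h.symm

theorem trace_conjTranspose_mul_vecMulVec (Z : Matrix n₁ n₂ ℂ) (v : n₁ → ℂ) (w : n₂ → ℂ) :
    (Zᴴ * vecMulVec v (star w)).trace = star (star v ⬝ᵥ (Z *ᵥ w)) := by
  rw [mul_vecMulVec, trace_vecMulVec, star_dotProduct, star_star, star_mulVec, dotProduct_comm,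
    dotProduct_mulVec]

/-- The single dyad of `(v, w)` is a competitor, with `V = v vᴴ` and `W = w wᴴ`. -/
theorem nonsymmGauge_vecMulVec_le {v : n₁ → ℂ} {w : n₂ → ℂ}
    (h : Sum.elim v w ∈ dict Φ Ψ (diagBlocks F₁ F₂) (diagBlocks G₁ G₂)) :
    nonsymmGauge Φ Ψ F₁ G₁ F₂ G₂ E₁ E₂ (vecMulVec v (star w))
      ≤ (((euclNorm (E₁ *ᵥ v) ^ 2 + euclNorm (E₂ *ᵥ w) ^ 2) / 2 : ℝ) : EReal) := by
  have hX : fromBlocks (vecMulVec v (star v)) (vecMulVec v (star w)) (vecMulVec v (star w))ᴴ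
      (vecMulVec w (star w)) = ∑ k : Fin 1, vecMulVec ((fun _ => Sum.elim v w) k)
        (star ((fun _ : Fin 1 => Sum.elim v w) k)) := by
    ext (i | i) (j | j) <;> simp [vecMulVec_apply]
  have hle : (⨅ (V : Matrix n₁ n₁ ℂ) (W : Matrix n₂ n₂ ℂ),
      symmGauge Φ Ψ (diagBlocks F₁ F₂) (diagBlocks G₁ G₂) (diagBlocks E₁ E₂)
        (fromBlocks V (vecMulVec v (star w)) (vecMulVec v (star w))ᴴ W))
      ≤ ((euclNorm (E₁ *ᵥ v) ^ 2 + euclNorm (E₂ *ᵥ w) ^ 2 : ℝ) : EReal) := by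
    refine (iInf₂_le (vecMulVec v (star v)) (vecMulVec w (star w))).trans ?_
    refine (iInf₂_le 1 fun _ => Sum.elim v w).trans ((iInf_le _ ⟨fun _ => h, hX⟩).trans ?_)
    rw [Fin.sum_univ_one, diagBlocks_mulVec, euclNorm_sq_sumElim]
  refine (mul_le_mul_of_nonneg_left hle (EReal.coe_nonneg.2 (by norm_num))).trans ?_
  rw [← EReal.coe_mul]
  exact EReal.coe_le_coe_iff.2 (by linarith)

/-- The off-diagonal block of a decomposition is the sum of the `vₖ wₖᴴ`, and the bound applies to
each term. -/
theorem SumBound.re_trace_le_nonsymmGauge (h : SumBound Φ Ψ F₁ G₁ F₂ G₂ E₁ E₂ Z)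
    (Y : Matrix n₁ n₂ ℂ) :
    (((Zᴴ * Y).trace.re : ℝ) : EReal) ≤ nonsymmGauge Φ Ψ F₁ G₁ F₂ G₂ E₁ E₂ Y := by
  have hle : ((2 * (Zᴴ * Y).trace.re : ℝ) : EReal) ≤
      ⨅ (V : Matrix n₁ n₁ ℂ) (W : Matrix n₂ n₂ ℂ),
        symmGauge Φ Ψ (diagBlocks F₁ F₂) (diagBlocks G₁ G₂) (diagBlocks E₁ E₂)
          (fromBlocks V Y Yᴴ W) := by
    refine le_iInf₂ fun V W => le_iInf₂ fun r a => le_iInf fun ⟨ha, hX⟩ => ?_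
    refine EReal.coe_le_coe_iff.2 ?_
    have hY : Y = ∑ k, vecMulVec (a k ∘ Sum.inl) (star (a k ∘ Sum.inr)) := by
      ext i j
      have := congrFun (congrFun hX (Sum.inl i)) (Sum.inr j)
      rw [fromBlocks_apply₁₂] at this
      rw [this, Matrix.sum_apply, Matrix.sum_apply]
      rfl
    rw [hY, Matrix.mul_sum, trace_sum, Complex.re_sum, Finset.mul_sum]
    refine Finset.sum_le_sum fun k _ => ?_
    have h1 := ha k
    rw [← Sum.elim_comp_inl_inr (a k)] at h1
    have h2 := h _ _ h1
    rw [trace_conjTranspose_mul_vecMulVec, Complex.star_def, Complex.conj_re,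
      ← Sum.elim_comp_inl_inr (a k), diagBlocks_mulVec, euclNorm_sq_sumElim]
    simp only [Sum.elim_comp_inl, Sum.elim_comp_inr] at h2 ⊢
    linarith
  refine le_trans ?_ (mul_le_mul_of_nonneg_left hle (EReal.coe_nonneg.2 (by norm_num)))
  rw [← EReal.coe_mul]
  exact EReal.coe_le_coe_iff.2 (by linarith)

theorem zero_mem_dict {p n : Type*} [Fintype n] {F G : Matrix p n ℂ}
    (hcurve : CurveNontrivial Φ Ψ) : 0 ∈ dict Φ Ψ F G := by
  obtain ⟨c, hc, -⟩ := hcurve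
  exact ⟨c, hc, mulVec_zero _⟩

theorem SumBound.conjugate_eq_zero (hcurve : CurveNontrivial Φ Ψ)
    (h : SumBound Φ Ψ F₁ G₁ F₂ G₂ E₁ E₂ Z) :
    conjugate (nonsymmGauge Φ Ψ F₁ G₁ F₂ G₂ E₁ E₂) Z = 0 := by
  refine le_antisymm (iSup_le fun Y => ?_) ?_
  · exact EReal.sub_nonpos.2 (h.re_trace_le_nonsymmGauge Y)
  -- The value zero is attained at `Y = 0`; the zero vector is in `𝒜` because the curve is nonempty.
  · have h0 : (Sum.elim 0 0 : n₁ ⊕ n₂ → ℂ) ∈ dict Φ Ψ (diagBlocks F₁ F₂) (diagBlocks G₁ G₂) := by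
      rw [Sum.elim_zero_zero]
      exact zero_mem_dict hcurve
    have h1 := nonsymmGauge_vecMulVec_le (E₁ := E₁) (E₂ := E₂) h0
    refine le_trans ?_ (le_iSup _ (vecMulVec 0 (star 0)))
    refine le_trans ?_ (EReal.sub_le_sub le_rfl h1)
    simp [euclNorm]

/-- Scaling a violating pair by `t` multiplies the excess `δ > 0` by `t²`. -/
theorem conjugate_eq_top_of_not_sumBound (h : ¬ SumBound Φ Ψ F₁ G₁ F₂ G₂ E₁ E₂ Z) :
    conjugate (nonsymmGauge Φ Ψ F₁ G₁ F₂ G₂ E₁ E₂) Z = ⊤ := by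
  simp only [SumBound, not_forall, not_le] at h
  obtain ⟨v, w, hvw, hlt⟩ := h
  rw [EReal.eq_top_iff_forall_lt]
  intro y
  set δ := (star v ⬝ᵥ (Z *ᵥ w)).re - (euclNorm (E₁ *ᵥ v) ^ 2 + euclNorm (E₂ *ᵥ w) ^ 2) / 2 with hδ
  have hδ0 : 0 < δ := sub_pos.2 hlt
  obtain ⟨t, ht0, ht⟩ : ∃ t : ℝ, 0 ≤ t ∧ y < t ^ 2 * δ := by
    refine ⟨√((|y| + 1) / δ), Real.sqrt_nonneg _, ?_⟩
    rw [Real.sq_sqrt (by positivity), div_mul_cancel₀ _ hδ0.ne']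
    linarith [le_abs_self y]
  have hmem := smul_mem_dict_diagBlocks hvw (t : ℂ) (t : ℂ)
  have hle := nonsymmGauge_vecMulVec_le (E₁ := E₁) (E₂ := E₂) hmem
  have hn : ‖(t : ℂ)‖ = t := by rw [Complex.norm_real, Real.norm_of_nonneg ht0]
  refine lt_of_lt_of_le ?_ (le_iSup _ (vecMulVec ((t : ℂ) • v) (star ((t : ℂ) • w))))
  refine lt_of_lt_of_le ?_ (EReal.sub_le_sub le_rfl hle)
  rw [← EReal.coe_sub]
  refine EReal.coe_lt_coe_iff.2 (ht.trans_eq ?_)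
  rw [trace_conjTranspose_mul_vecMulVec, mulVec_smul, mulVec_smul, mulVec_smul, euclNorm_smul,
    euclNorm_smul, hn, star_smul, smul_dotProduct, dotProduct_smul, Complex.star_def,
    Complex.conj_re, Complex.conj_ofReal, smul_eq_mul, smul_eq_mul,
    Complex.re_ofReal_mul, Complex.re_ofReal_mul, hδ]
  ring

theorem conjugate_eq_zero_iff (hcurve : CurveNontrivial Φ Ψ) :
    conjugate (nonsymmGauge Φ Ψ F₁ G₁ F₂ G₂ E₁ E₂) Z = 0 ↔
      SumBound Φ Ψ F₁ G₁ F₂ G₂ E₁ E₂ Z := by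
  refine ⟨fun h => ?_, SumBound.conjugate_eq_zero hcurve⟩
  by_contra hn
  rw [conjugate_eq_top_of_not_sumBound hn] at h
  exact EReal.top_ne_zero h

end Blocks

/-! ### State-space pencils and transfer functions -/

section StateSpace

theorem smul_mem_curve {Φ Ψ : Matrix (Fin 2) (Fin 2) ℂ} {μ ν k : ℂ} (hk : k ≠ 0)
    (h : (μ, ν) ∈ curve Φ Ψ) : (k * μ, k * ν) ∈ curve Φ Ψ := by
  obtain ⟨h0, h1, h2⟩ := h
  have hq : ∀ Θ, quadForm Θ (k * μ) (k * ν) = (Complex.normSq k : ℂ) * quadForm Θ μ ν := by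
    intro Θ
    rw [← Complex.mul_conj, quadForm_eq, quadForm_eq, star_mul', star_mul', Complex.star_def]
    ring
  refine ⟨?_, ?_, ?_⟩
  · intro h
    simp only [Prod.mk_eq_zero, mul_eq_zero, hk, false_or] at h
    exact h0 (Prod.ext h.1 h.2)
  · rw [hq, h1, mul_zero]
  · rw [hq, Complex.re_ofReal_mul]
    exact mul_nonpos_of_nonneg_of_nonpos (Complex.normSq_nonneg k) h2

variable {Φ Ψ : Matrix (Fin 2) (Fin 2) ℂ} {s m l : Type*} [Fintype s] [Fintype m] [Fintype l]

theorem fullRowRank_diagBlocks_of_isEmpty {p₁ p₂ n₁ n₂ : Type*} [Fintype p₁] [IsEmpty p₁]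
    [Fintype p₂] [Fintype n₁] [Fintype n₂] (F₁ G₁ : Matrix p₁ n₁ ℂ) {F₂ G₂ : Matrix p₂ n₂ ℂ}
    (h : FullRowRank F₂ G₂) : FullRowRank (diagBlocks F₁ F₂) (diagBlocks G₁ G₂) := by
  intro μ ν hc
  have h1 := (rank_eq_card_iff_forall_exists_mulVec_eq _).1 (h μ ν hc)
  refine (rank_eq_card_iff_forall_exists_mulVec_eq _).2 fun y => ?_
  obtain ⟨a, ha⟩ := h1 (y ∘ Sum.inr)
  refine ⟨Sum.elim 0 a, ?_⟩
  rw [pencil_diagBlocks, diagBlocks_mulVec, ha]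
  ext (i | i)
  · exact isEmptyElim i
  · rfl

theorem isUnit_det_of_not_hasEigenvalue [DecidableEq s] {A : Matrix s s ℂ} {z : ℂ}
    (h : ¬ Module.End.HasEigenvalue (Matrix.toLin' A) z) :
    IsUnit (z • (1 : Matrix s s ℂ) - A).det := by
  rw [isUnit_iff_ne_zero]
  intro h0
  obtain ⟨x, hx, hxA⟩ := exists_mulVec_eq_zero_iff.2 h0
  refine h (Module.End.hasEigenvalue_of_hasEigenvector (x := x)
    ⟨Module.End.mem_eigenspace_iff.2 ?_, hx⟩)
  rw [sub_mulVec, smul_mulVec, one_mulVec, sub_eq_zero] at hxA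
  rw [toLin'_apply, hxA]

theorem statePencil_mulVec [DecidableEq s] (A : Matrix s s ℂ) (B : Matrix s m ℂ) (μ ν : ℂ)
    (x : s → ℂ) (u : m → ℂ) :
    (μ • (fromCols 1 0 : Matrix s (s ⊕ m) ℂ) - ν • fromCols A B) *ᵥ Sum.elim x u
      = μ • x - ν • (A *ᵥ x + B *ᵥ u) := by
  rw [sub_mulVec, smul_mulVec, smul_mulVec, fromCols_mulVec_sumElim, fromCols_mulVec_sumElim]
  simp

/-- At a point with `ν ≠ 0`, scaled to `(λ, 1)`, the kernel consists of the `(x, u)` with `x = (λ I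
- A)⁻¹ B u`, the inverse existing by the eigenvalue condition. At infinity the kernel is `x = 0`
with `u` free, which leaves `D`. -/
theorem transferBound_iff [DecidableEq s] [DecidableEq m] {A : Matrix s s ℂ} {B : Matrix s m ℂ}
    {C : Matrix l s ℂ} {D : Matrix l m ℂ}
    (hA : ∀ z : ℂ, Module.End.HasEigenvalue (Matrix.toLin' A) z → (z, (1 : ℂ)) ∉ curve Φ Ψ) :
    (∀ w ∈ dict Φ Ψ (fromCols A B) (fromCols 1 0),
      euclNorm (fromCols C D *ᵥ w) ≤ euclNorm ((fromCols 0 1 : Matrix m (s ⊕ m) ℂ) *ᵥ w)) ↔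
      TransferBound Φ Ψ A B C D := by
  have hE : ∀ (x : s → ℂ) (u : m → ℂ),
      (fromCols 0 1 : Matrix m (s ⊕ m) ℂ) *ᵥ Sum.elim x u = u := by
    intro x u
    rw [fromCols_mulVec_sumElim]
    simp
  have hunit : ∀ z : ℂ, (z, (1 : ℂ)) ∈ curve Φ Ψ → IsUnit (z • (1 : Matrix s s ℂ) - A).det :=
    fun z hz => isUnit_det_of_not_hasEigenvalue fun h => hA z h hz
  have htf : ∀ (z : ℂ) (u : m → ℂ), fromCols C D *ᵥ Sum.elim ((z • (1 : Matrix s s ℂ) - A)⁻¹ *ᵥ B *ᵥ u) u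
      = (D + C * (z • (1 : Matrix s s ℂ) - A)⁻¹ * B) *ᵥ u := by
    intro z u
    rw [fromCols_mulVec_sumElim, add_mulVec, ← mulVec_mulVec, ← mulVec_mulVec, add_comm]
  constructor
  · refine fun h => ⟨fun z hz => (specNorm_le_one_iff _).2 fun u => ?_,
      fun hinf => (specNorm_le_one_iff _).2 fun u => ?_⟩
    · have := h (Sum.elim ((z • (1 : Matrix s s ℂ) - A)⁻¹ *ᵥ B *ᵥ u) u) ⟨(z, 1), hz, by
        rw [statePencil_mulVec, one_smul, ← sub_sub]
        have h1 : (z • (1 : Matrix s s ℂ) - A) *ᵥ ((z • (1 : Matrix s s ℂ) - A)⁻¹ *ᵥ B *ᵥ u)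
            = B *ᵥ u := by
          rw [mulVec_mulVec, mul_nonsing_inv _ (hunit z hz), one_mulVec]
        rw [sub_mulVec, smul_mulVec, one_mulVec] at h1
        rw [h1, sub_self]⟩
      rwa [hE, htf] at this
    · have := h (Sum.elim 0 u) ⟨(1, 0), hinf, by rw [statePencil_mulVec]; simp⟩
      rw [hE, fromCols_mulVec_sumElim] at this
      simpa using this
  · rintro ⟨hfin, hinf⟩ w ⟨⟨μ, ν⟩, hc, hw⟩
    obtain ⟨x, u, rfl⟩ : ∃ x u, w = Sum.elim x u :=
      ⟨w ∘ Sum.inl, w ∘ Sum.inr, (Sum.elim_comp_inl_inr w).symm⟩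
    rw [statePencil_mulVec] at hw
    simp only at hw
    by_cases hν : ν = 0
    · subst hν
      have hμ : μ ≠ 0 := by
        rintro rfl
        exact hc.1 rfl
      rw [zero_smul, sub_zero, smul_eq_zero, or_iff_right hμ] at hw
      have h1 := smul_mem_curve (inv_ne_zero hμ) hc
      rw [inv_mul_cancel₀ hμ, mul_zero] at h1
      rw [hE, hw, fromCols_mulVec_sumElim, mulVec_zero, zero_add]
      exact (specNorm_le_one_iff _).1 (hinf h1) u
    · have h1 := smul_mem_curve (inv_ne_zero hν) hc
      rw [inv_mul_cancel₀ hν] at h1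
      have hx : x = ((ν⁻¹ * μ) • (1 : Matrix s s ℂ) - A)⁻¹ *ᵥ B *ᵥ u := by
        have h2 : ((ν⁻¹ * μ) • (1 : Matrix s s ℂ) - A) *ᵥ x = B *ᵥ u := by
          rw [sub_mulVec, smul_mulVec, one_mulVec, mul_smul, sub_eq_zero.1 hw,
            inv_smul_smul₀ hν, add_sub_cancel_left]
        rw [← h2, mulVec_mulVec, nonsing_inv_mul _ (hunit (ν⁻¹ * μ) h1), one_mulVec]
      rw [hE, hx, htf]
      exact (specNorm_le_one_iff _).1 (hfin _ h1) u

theorem prodBound_iff_of_isEmpty {p₁ p₂ n₂ m₂ : Type*} [IsEmpty p₁] [Fintype p₁] [Fintype p₂]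
    [Fintype n₂] [Fintype m₂] [DecidableEq l] (F₁ G₁ : Matrix p₁ l ℂ) {F₂ G₂ : Matrix p₂ n₂ ℂ}
    {E₂ : Matrix m₂ n₂ ℂ} {Z : Matrix l n₂ ℂ} :
    ProdBound Φ Ψ F₁ G₁ F₂ G₂ (1 : Matrix l l ℂ) E₂ Z ↔
      ∀ w ∈ dict Φ Ψ F₂ G₂, euclNorm (Z *ᵥ w) ≤ euclNorm (E₂ *ᵥ w) := by
  constructor
  · intro h w ⟨c, hc, hw⟩
    -- With no rows in the first block, `v` is free; `v = Z w` is the equality case of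
    -- Cauchy-Schwarz.
    have h1 := h (Z *ᵥ w) w (mem_dict_diagBlocks.2 ⟨c, hc, Subsingleton.elim _ _, hw⟩)
    rw [star_dotProduct_self_eq, Complex.ofReal_re, one_mulVec, sq] at h1
    rcases (euclNorm_nonneg (Z *ᵥ w)).eq_or_lt with h0 | h0
    · rw [← h0]
      exact euclNorm_nonneg _
    · exact le_of_mul_le_mul_left h1 h0
  · intro h v w hvw
    obtain ⟨c, hc, -, hw⟩ := mem_dict_diagBlocks.1 hvw
    rw [one_mulVec]
    exact (re_star_dotProduct_le _ _).trans
      (mul_le_mul_of_nonneg_left (h w ⟨c, hc, hw⟩) (euclNorm_nonneg v))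

end StateSpace

end PencilGauge

theorem mainTheorem5 (Φ Ψ : Matrix (Fin 2) (Fin 2) ℂ) (hΦ : Φ.IsHermitian) (hΨ : Ψ.IsHermitian)
    (hdet : Φ.det.re < 0) (hcurve : PencilGauge.CurveNontrivial Φ Ψ) :
    -- the conjugate of the gauge of a block-diagonal pencil
    (∀ (p₁ p₂ n₁ n₂ m₁ m₂ : Type*) [Fintype p₁] [Fintype p₂] [Fintype n₁] [Fintype n₂]
      [Fintype m₁] [Fintype m₂]
      (F₁ G₁ : Matrix p₁ n₁ ℂ) (F₂ G₂ : Matrix p₂ n₂ ℂ)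
      (E₁ : Matrix m₁ n₁ ℂ) (E₂ : Matrix m₂ n₂ ℂ),
      PencilGauge.FullRowRank (PencilGauge.diagBlocks F₁ F₂) (PencilGauge.diagBlocks G₁ G₂) →
      ∀ Z : Matrix n₁ n₂ ℂ,
        (PencilGauge.conjugate (PencilGauge.nonsymmGauge Φ Ψ F₁ G₁ F₂ G₂ E₁ E₂) Z = 0 ↔
          PencilGauge.LMIFeasible Φ Ψ F₁ G₁ F₂ G₂ E₁ E₂ Z) ∧
        (¬ PencilGauge.LMIFeasible Φ Ψ F₁ G₁ F₂ G₂ E₁ E₂ Z →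
          PencilGauge.conjugate (PencilGauge.nonsymmGauge Φ Ψ F₁ G₁ F₂ G₂ E₁ E₂) Z = ⊤) ∧
        (PencilGauge.LMIFeasible Φ Ψ F₁ G₁ F₂ G₂ E₁ E₂ Z ↔
          ∀ (v : n₁ → ℂ) (w : n₂ → ℂ),
            Sum.elim v w ∈ PencilGauge.dict Φ Ψ
              (PencilGauge.diagBlocks F₁ F₂) (PencilGauge.diagBlocks G₁ G₂) →
            (star v ⬝ᵥ (Z *ᵥ w)).re ≤
              (PencilGauge.euclNorm (E₁ *ᵥ v) ^ 2 + PencilGauge.euclNorm (E₂ *ᵥ w) ^ 2) / 2) ∧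
        (PencilGauge.LMIFeasible Φ Ψ F₁ G₁ F₂ G₂ E₁ E₂ Z ↔
          ∀ (v : n₁ → ℂ) (w : n₂ → ℂ),
            Sum.elim v w ∈ PencilGauge.dict Φ Ψ
              (PencilGauge.diagBlocks F₁ F₂) (PencilGauge.diagBlocks G₁ G₂) →
            (star v ⬝ᵥ (Z *ᵥ w)).re ≤
              PencilGauge.euclNorm (E₁ *ᵥ v) * PencilGauge.euclNorm (E₂ *ᵥ w))) ∧
    -- the state-space pencil: `p₁ = 0`, `G₂ = [I 0]`, `F₂ = [A B]`, `E₁ = I`, `E₂ = [0 I]`,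
    -- `Z = [C D]`
    (∀ (s m l : Type*) [Fintype s] [Fintype m] [Fintype l] [DecidableEq s] [DecidableEq m]
      [DecidableEq l]
      (A : Matrix s s ℂ) (B : Matrix s m ℂ) (C : Matrix l s ℂ) (D : Matrix l m ℂ),
      (∀ z : ℂ, Module.End.HasEigenvalue (Matrix.toLin' A) z →
        (z, (1 : ℂ)) ∉ PencilGauge.curve Φ Ψ) →
      ∀ (F₁ G₁ : Matrix (Fin 0) l ℂ) (F₂ G₂ : Matrix s (s ⊕ m) ℂ)
        (E₁ : Matrix l l ℂ) (E₂ : Matrix m (s ⊕ m) ℂ) (Z : Matrix l (s ⊕ m) ℂ),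
        F₂ = fromCols A B → G₂ = fromCols 1 0 → E₁ = 1 → E₂ = fromCols 0 1 →
        Z = fromCols C D →
        ((∀ (v : l → ℂ) (w : s ⊕ m → ℂ),
            Sum.elim v w ∈ PencilGauge.dict Φ Ψ
              (PencilGauge.diagBlocks F₁ F₂) (PencilGauge.diagBlocks G₁ G₂) →
            (star v ⬝ᵥ (Z *ᵥ w)).re ≤
              PencilGauge.euclNorm (E₁ *ᵥ v) * PencilGauge.euclNorm (E₂ *ᵥ w)) ↔
          ∀ w ∈ PencilGauge.dict Φ Ψ F₂ G₂,
            PencilGauge.euclNorm (Z *ᵥ w) ≤ PencilGauge.euclNorm (E₂ *ᵥ w)) ∧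
        ((∀ w ∈ PencilGauge.dict Φ Ψ F₂ G₂,
            PencilGauge.euclNorm (Z *ᵥ w) ≤ PencilGauge.euclNorm (E₂ *ᵥ w)) ↔
          PencilGauge.TransferBound Φ Ψ A B C D) ∧
        (PencilGauge.conjugate (PencilGauge.nonsymmGauge Φ Ψ F₁ G₁ F₂ G₂ E₁ E₂) Z = 0 ↔
          PencilGauge.TransferBound Φ Ψ A B C D) ∧
        (¬ PencilGauge.TransferBound Φ Ψ A B C D →
          PencilGauge.conjugate (PencilGauge.nonsymmGauge Φ Ψ F₁ G₁ F₂ G₂ E₁ E₂) Z = ⊤) ∧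
        (PencilGauge.FullRowRank F₂ G₂ →
          (PencilGauge.LMIFeasible Φ Ψ F₁ G₁ F₂ G₂ E₁ E₂ Z ↔
            PencilGauge.TransferBound Φ Ψ A B C D))) := by
  constructor
  · intro p₁ p₂ n₁ n₂ m₁ m₂ _ _ _ _ _ _ F₁ G₁ F₂ G₂ E₁ E₂ hrank Z
    have hLMI := PencilGauge.lmiFeasible_iff_sumBound (E₁ := E₁) (E₂ := E₂) (Z := Z) hΦ hΨ hdet
      hcurve hrank
    refine ⟨?_, fun h => ?_, hLMI, hLMI.trans PencilGauge.sumBound_iff_prodBound⟩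
    · rw [PencilGauge.conjugate_eq_zero_iff hcurve, hLMI]
    · exact PencilGauge.conjugate_eq_top_of_not_sumBound (mt hLMI.2 h)
  · intro s m l _ _ _ _ _ _ A B C D hA F₁ G₁ F₂ G₂ E₁ E₂ Z hF₂ hG₂ hE₁ hE₂ hZ
    subst hF₂ hG₂ hE₁ hE₂ hZ
    have hprod := PencilGauge.prodBound_iff_of_isEmpty (Φ := Φ) (Ψ := Ψ) F₁ G₁
      (F₂ := fromCols A B) (G₂ := fromCols 1 0) (E₂ := (fromCols 0 1 : Matrix m (s ⊕ m) ℂ))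
      (Z := fromCols C D)
    have htf := PencilGauge.transferBound_iff (C := C) (D := D) (B := B) hA
    have hsum := PencilGauge.sumBound_iff_prodBound.trans (hprod.trans htf)
    refine ⟨hprod, htf, ?_, fun h => ?_, fun hrank => ?_⟩
    · rw [PencilGauge.conjugate_eq_zero_iff hcurve, hsum]
    · exact PencilGauge.conjugate_eq_top_of_not_sumBound (mt hsum.1 h)
    · rw [PencilGauge.lmiFeasible_iff_sumBound hΦ hΨ hdet hcurve
        (PencilGauge.fullRowRank_diagBlocks_of_isEmpty F₁ G₁ hrank), hsum]
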